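/- **Setting.** Let $G$ be a finite graph, $C\subseteq V(G)$, and let $H$ be a graph with $\emptyset\neq V(H)\subseteq C$ and $E(H)\subseteq E(G)$. Let $\mathcal I$ be the set of connected components of $G-C$. For $I\in\mathcal I$ let $N_C(I)$ (resp. $N^s_C(I)$) be the set of $c\in C$ adjacent to some (resp. every) vertex of $I$, and put $C(I)=C\setminus N^s_C(I)$, $C^s(I)=C\setminus N_C(I)$. The component $I$ is *simple* if $C(I)=C^s(I)$, and *ambiguous* if $G[C\cup I]$ has an interval model whose leftmost clique is $C$; $\mathcal I_a$ is the set of ambiguous components. For distinct $I,J$ write $I\sqsubset J$ if $C(I)\subseteq C^s(J)$, and let $\sqsubseteq$ be the reflexive closure of $\sqsubset$. A chain $\mathcal A$ of $(\mathcal I_a,\sqsubseteq)$ *respects* a clique $B$ of $H$ if $B\subseteq C^s(I)$ for all $I\in\mathcal A$. **Models.** The lollipop consists of a cycle $L_\circ$ with an edge $L_|$ (the stick) attached at a point $P$. A *$(C,H)$-centered model* $\phi$ of $G$ represents $G$ as the intersection graph of connected subgraphs $\phi(v)$ of a subdivision of the lollipop, such that $P\in\phi(v)$ iff $v\in C$ and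 the following holds. Let $\mathcal I^\phi_\circ$ (resp. $\mathcal I^\phi_|$) be the set of components represented on $L_\circ\setminus P$ (resp. $L_|\setminus P$), let $\prec_\phi$ be their left-to-right order on $L_\circ\setminus P$, and for $v\in C$ let $J(v)=\{I\in\mathcal I^\phi_\circ: v\in C(I)\}$ (always an interval of $(\mathcal I^\phi_\circ,\prec_\phi)$). Then the sets $J(v)$ form an interval model of $H$: $v\in V(H)$ iff $J(v)\ne\emptyset$, and distinct $u,v$ are adjacent in $H$ iff $J(u)\cap J(v)\neq\emptyset$. Let $\mathcal D$ be the set of all $I\in\mathcal I_a$ that belong to $\mathcal I^\phi_|$ for every $(C,H)$-centered model $\phi$, and let $\mathcal I'=\mathcal I\setminus\mathcal D$. **PQ-tree.** Let $\mathbb T$ be a PQ-tree of $H$ with root $\mathbb R$: its leaves $\mathbb L$ correspond to the maximal cliques $C(\mathbb L)$ of $H$, P-nodes have at least two children, which may be permuted arbitrarily, Q-nodes have at least three children, whose order may only be reversed, and the admissible leaf orders are exactly the consecutive orderings of the maximal cliques of $H$. **Standing assumptions on the instance.** (a) Distinct ambiguous simple components have distinct sets $C(I)$ (equivalently, $\sqsubset$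 is a strict partial order on $\mathcal I_a$). (b) There is no ambiguous simple component $I$ with $C(I)=C(S)$ for a minimal sector $S$ of an interval model of $H$; that is, for every consecutive ordering $\mathbb L_1,\dots,\mathbb L_n$ of the maximal cliques and every $0\le i\le n$ we have $C(I)\ne C(\mathbb L_i)\cap C(\mathbb L_{i+1})$, where $C(\mathbb L_0)=C(\mathbb L_{n+1})=\emptyset$. **Good orders for the root.** Let $\prec$ be a strict linear order on $\mathcal K\subseteq\mathcal I'$; for sets of components, $\mathcal A\prec\mathcal B$ means $I\prec J$ for all $I\in\mathcal A$, $J\in\mathcal B$. Put $inner(\mathbb L)=\{I\in\mathcal K: C(I)=C(\mathbb L)\}$. $(\mathcal K,\prec)$ is *good for $\mathbb R$* if every $inner(\mathbb L)$ is a nonempty interval of $(\mathcal K,\prec)$, the order $\mathbb L_1,\dots,\mathbb L_n$ of the leaves given by $inner(\mathbb L_1)\prec\dots\prec inner(\mathbb L_n)$ is admissible for $\mathbb R$, and conditions 1–4 below hold. Let $C(\mathbb L_0)=C(\mathbb L_{n+1})=\emptyset$, $B_i=C(\mathbb L_i)\cap C(\mathbb L_{i+1})$, $$zone_L(\mathbb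 L_i)=\{I\in\mathcal K: I\prec inner(\mathbb L_i),\ C(I)\cap(C(\mathbb L_i)\setminus C(\mathbb L_{i-1}))\neq\emptyset\},$$ $$zone_R(\mathbb L_i)=\{I\in\mathcal K: inner(\mathbb L_i)\prec I,\ C(I)\cap(C(\mathbb L_i)\setminus C(\mathbb L_{i+1}))\neq\emptyset\},$$ and $zone(\mathbb L_i)=zone_L(\mathbb L_i)\cup inner(\mathbb L_i)\cup zone_R(\mathbb L_i)$. 1. The sets $zone(\mathbb L_i)$, $i\in[n]$, partition $\mathcal K$ and $zone(\mathbb L_1)\prec\dots\prec zone(\mathbb L_n)$. 2. For every $i\in[n]$, $zone_L(\mathbb L_i)$ is a chain of $(\mathcal I_a,\sqsubseteq)$ that respects $B_{i-1}$, and $\sqsubset$ equals $\prec$ on it; $zone_R(\mathbb L_i)$ is a chain of $(\mathcal I_a,\sqsubseteq)$ that respects $B_i$, and $\sqsubset$ equals the reverse of $\prec$ on it. 3. If $|inner(\mathbb L_i)|\ge2$ and $I_L$, $I_R$ are its leftmost and rightmost elements, then $inner(\mathbb L_i)\subseteq\mathcal I_a$; the set $inner(\mathbb L_i)\setminus\{I_L,I_R\}$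 is empty or consists of a single ambiguous simple component; $I\sqsubset I_L$ for all $I\in zone_L(\mathbb L_i)$, and the chain $zone_L(\mathbb L_i)\cup\{I_L\}$ respects $B_{i-1}$; $I\sqsubset I_R$ for all $I\in zone_R(\mathbb L_i)$, and the chain $zone_R(\mathbb L_i)\cup\{I_R\}$ respects $B_i$. 4. If $inner(\mathbb L_i)=\{I_S\}$, let $C_L=C(I')$ for the $\sqsubseteq$-maximum $I'$ of $zone_L(\mathbb L_i)$ if this zone is nonempty and $C_L=B_{i-1}$ otherwise, and let $C_R=C(I')$ for the $\sqsubseteq$-maximum $I'$ of $zone_R(\mathbb L_i)$ if this zone is nonempty and $C_R=B_i$ otherwise. Then $C_L$ and $C_R$ are cliques of $H$, $N_C(I_S)\setminus N^s_C(I_S)\subseteq(C\setminus C_L)\cup(C\setminus C_R)$, and the graph $G^{ext}(C_L,I_S,C_R)$ is a circular-arc graph. Here $G^{ext}(C_L,I_S,C_R)$ is $G[C\cup I_S]$ together with two new non-adjacent vertices $v_L,v_R$ with neighbourhoods $C\setminus C_L$ and $C\setminus C_R$. **Lemma.** For every $(C,H)$-centered model $\phi$ of $G$, the pair $(\mathcal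 I^\phi_\circ,\prec_\phi)$ is good for $\mathbb R$ (in particular, $\prec_\phi$ is a strict linear order on $\mathcal I^\phi_\circ\subseteq\mathcal I'$). -/

import Mathlib

open SimpleGraph

namespace CenteredLollipop

/-! ### Intersection models on host graphs -/

/-- `φ` represents `F` as an intersection graph of (nonempty) connected subgraphs of `X`. -/
structure IsModel {V W : Type*} (X : SimpleGraph W) (F : SimpleGraph V) (φ : V → Set W) :
    Prop where
  connected : ∀ v, (X.induce (φ v)).Connected
  adj_iff : ∀ u v, u ≠ v → (F.Adj u v ↔ (φ u ∩ φ v).Nonempty)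

/-- Circular-arc graphs: intersection graphs of connected subgraphs of a cycle. -/
def IsCircularArc {V : Type*} (F : SimpleGraph V) : Prop :=
  ∃ (m : ℕ) (ψ : V → Set (Fin (m + 3))), IsModel (cycleGraph (m + 3)) F ψ

/-- The subdivisions of the lollipop (a cycle with an edge attached to it): the circle part consists
of the vertices `Sum.inl i`, the vertices `Sum.inr j` form the stick part without its end `P`. -/
def lollipop (m s : ℕ) : SimpleGraph (Fin (m + 3) ⊕ Fin (s + 1)) :=
  (cycleGraph (m + 3) ⊕g pathGraph (s + 1)) ⊔ SimpleGraph.edge (Sum.inl 0) (Sum.inr 0)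

/-- The point `P` at which the stick is attached to the circle. -/
def pointP (m s : ℕ) : Fin (m + 3) ⊕ Fin (s + 1) := Sum.inl 0

section Components

variable {V : Type*} (G : SimpleGraph V) (C : Set V)

/-- The connected components of `G - C`. -/
abbrev Comp : Type _ := (G.induce Cᶜ).ConnectedComponent

variable {G C}

/-- The set of vertices of a component. -/
def verts (I : Comp G C) : Set V := Subtype.val '' I.supp

/-- `N_C(I)`: the vertices of `C` adjacent to some vertex of `I`. -/
def nbr (I : Comp G C) : Set V := {c | c ∈ C ∧ ∃ v ∈ verts I, G.Adj c v}

/-- `N^s_C(I)`: the vertices of `C` adjacent to all vertices of `I`. -/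
def strongNbr (I : Comp G C) : Set V := {c | c ∈ C ∧ ∀ v ∈ verts I, G.Adj c v}

/-- `C(I)`: the vertices of `C` not adjacent to some vertex of `I`. -/
def cl (I : Comp G C) : Set V := C \ strongNbr I

/-- `C^s(I)`: the vertices of `C` adjacent to no vertex of `I`. -/
def clStrong (I : Comp G C) : Set V := C \ nbr I

/-- `I` is simple: every vertex of `C` is adjacent to all or to none of the vertices of `I`. -/
def IsSimple (I : Comp G C) : Prop := cl I = clStrong I

/-- `I` is ambiguous: `G[C ∪ I]` has an interval model (connected subgraphs of a path) whose
leftmost clique is `C`. -/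
def IsAmbiguous (I : Comp G C) : Prop :=
  ∃ (n : ℕ) (ψ : ↥(C ∪ verts I) → Set (Fin (n + 1))),
    IsModel (pathGraph (n + 1)) (G.induce (C ∪ verts I)) ψ ∧ ∀ v, (0 : Fin (n + 1)) ∈ ψ v ↔ v.1 ∈ C

/-- `I ⊏ J`. -/
def sqLT (I J : Comp G C) : Prop := I ≠ J ∧ cl I ⊆ clStrong J

/-- `I ⊑ J`, the reflexive closure of `⊏`. -/
def sqLE (I J : Comp G C) : Prop := I = J ∨ sqLT I J

/-- `A` is a chain in the poset of ambiguous components ordered by `⊑`. -/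
def IsSqChain (A : Set (Comp G C)) : Prop :=
  (∀ I ∈ A, IsAmbiguous I) ∧ ∀ I ∈ A, ∀ J ∈ A, sqLE I J ∨ sqLE J I

/-- `A` is a chain in the poset of ambiguous components that respects the border `B`. -/
def RespectsBorder (A : Set (Comp G C)) (B : Set V) : Prop :=
  IsSqChain A ∧ ∀ I ∈ A, B ⊆ clStrong I

/-- `G^ext(C_L, I, C_R)`: the graph `G[C ∪ I]` with two new non-adjacent vertices
`v_L = Sum.inr false` and `v_R = Sum.inr true`, whose neighbourhoods are `C \ C_L` and `C \ C_R`. -/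
def extGraph (CL : Set V) (I : Comp G C) (CR : Set V) :
    SimpleGraph (↥(C ∪ verts I) ⊕ Bool) where
  Adj x y :=
    match x, y with
    | Sum.inl u, Sum.inl v => G.Adj u v
    | Sum.inl u, Sum.inr b => u.1 ∈ C \ (if b then CR else CL)
    | Sum.inr b, Sum.inl u => u.1 ∈ C \ (if b then CR else CL)
    | Sum.inr _, Sum.inr _ => False
  symm := ⟨by
    rintro (u | b) (v | b') h
    · exact G.adj_symm h
    · exact h
    · exact h
    · exact h⟩
  loopless := ⟨by
    rintro (u | b) h
    · exact G.irrefl h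
    · exact h⟩

end Components

section Models

variable {V : Type*} {G : SimpleGraph V} {C : Set V} {m s : ℕ}

/-- The components placed by `φ` on the circle part. -/
def onCircle (C : Set V) (φ : V → Set (Fin (m + 3) ⊕ Fin (s + 1))) : Set (Comp G C) :=
  {I | ∀ v ∈ verts I, φ v ⊆ Set.range Sum.inl}

/-- The components placed by `φ` on the stick part. -/
def onStick (C : Set V) (φ : V → Set (Fin (m + 3) ⊕ Fin (s + 1))) : Set (Comp G C) :=
  {I | ∀ v ∈ verts I, φ v ⊆ Set.range Sum.inr}

/-- `I ≺_φ J`: on the circle cut open at `P`, the component `I` lies to the left of `J`. -/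
def precModel (φ : V → Set (Fin (m + 3) ⊕ Fin (s + 1))) (I J : Comp G C) : Prop :=
  ∀ u ∈ verts I, ∀ v ∈ verts J, ∀ i j : Fin (m + 3), Sum.inl i ∈ φ u → Sum.inl j ∈ φ v → i < j

/-- `φ` is a `(C,H)`-centered model of `G`: a lollipop model in which `C` is the set of vertices
whose subgraphs contain `P`, and in which the sets `{I ∈ 𝓘_∘ | v ∈ C(I)}` of circle components not
covered by `v` represent `H`: they are nonempty exactly for the vertices `v` of `H`, and two of them
intersect exactly if the two vertices are adjacent in `H`. (They are automatically intervals in the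
left to right order of the components on the circle.) -/
structure IsCenteredModel (G : SimpleGraph V) (C : Set V) (H : G.Subgraph)
    (φ : V → Set (Fin (m + 3) ⊕ Fin (s + 1))) : Prop where
  model : IsModel (lollipop m s) G φ
  center : ∀ v, pointP m s ∈ φ v ↔ v ∈ C
  verts_iff : ∀ v, v ∈ H.verts ↔ ∃ I : Comp G C, I ∈ onCircle C φ ∧ v ∈ cl I
  adj_iff : ∀ u v, u ≠ v →
    (H.Adj u v ↔ ∃ I : Comp G C, I ∈ onCircle C φ ∧ u ∈ cl I ∧ v ∈ cl I)

/-- `𝓓`: the ambiguous components that lie on the stick in every `(C,H)`-centered model of `G`. -/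
def deleted (G : SimpleGraph V) (C : Set V) (H : G.Subgraph) : Set (Comp G C) :=
  {I | IsAmbiguous I ∧ ∀ (m s : ℕ) (φ : V → Set (Fin (m + 3) ⊕ Fin (s + 1))),
    IsCenteredModel G C H φ → I ∈ onStick C φ}

end Models

/-! ### PQ-trees -/

/-- PQ-trees with leaves labelled by elements of `α`. -/
inductive PQTree (α : Type*) where
  | leaf (a : α) : PQTree α
  | pnode (children : List (PQTree α)) : PQTree α
  | qnode (children : List (PQTree α)) : PQTree α

/-- A PQ-tree is proper if its P-nodes have at least two and its Q-nodes at least three children. -/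
inductive PQTree.Proper {α : Type*} : PQTree α → Prop
  | leaf (a : α) : Proper (.leaf a)
  | pnode (cs : List (PQTree α)) (hlen : 2 ≤ cs.length) (h : ∀ c ∈ cs, Proper c) :
      Proper (.pnode cs)
  | qnode (cs : List (PQTree α)) (hlen : 3 ≤ cs.length) (h : ∀ c ∈ cs, Proper c) :
      Proper (.qnode cs)

/-- `N.Admissible l`: `l` is an admissible order of the leaves below the node `N`, obtained by
permuting the children of P-nodes arbitrarily and possibly reversing the children of Q-nodes. -/
inductive PQTree.Admissible {α : Type*} : PQTree α → List α → Prop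
  | leaf (a : α) : Admissible (.leaf a) [a]
  | pnode (cs cs' : List (PQTree α)) (ls : List (List α)) (hcs : cs'.Perm cs)
      (h : List.Forall₂ Admissible cs' ls) : Admissible (.pnode cs) ls.flatten
  | qnode (cs cs' : List (PQTree α)) (ls : List (List α)) (hcs : cs' = cs ∨ cs' = cs.reverse)
      (h : List.Forall₂ Admissible cs' ls) : Admissible (.qnode cs) ls.flatten

section Orders

variable {V : Type*} {G : SimpleGraph V} {C : Set V}

/-- Cliques of `H`. -/
def IsCliqueOf (H : G.Subgraph) (M : Set V) : Prop :=
  M ⊆ H.verts ∧ ∀ u ∈ M, ∀ v ∈ M, u ≠ v → H.Adj u v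

/-- Inclusion-maximal cliques of `H`. -/
def IsMaxCliqueOf (H : G.Subgraph) (M : Set V) : Prop :=
  IsCliqueOf H M ∧ ∀ M', IsCliqueOf H M' → M ⊆ M' → M' = M

/-- For a list `𝕃₁, …, 𝕃ₙ` of cliques, `cliqueAt BL BR l i` is `C(𝕃ᵢ)` if `1 ≤ i ≤ n`, with the
conventions `C(𝕃₀) = BL` and `C(𝕃ₙ₊₁) = BR`. -/
def cliqueAt (BL BR : Set V) (l : List (Set V)) (i : ℕ) : Set V :=
  if i = 0 then BL else l.getD (i - 1) BR

/-- `l` is a consecutive ordering of the maximal cliques of `H`: each of them occurs once, and the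
cliques containing any given vertex are consecutive. -/
def IsConsecutive (H : G.Subgraph) (l : List (Set V)) : Prop :=
  l.Nodup ∧ (∀ M, M ∈ l ↔ IsMaxCliqueOf H M) ∧
    ∀ v, ∀ i j k : ℕ, 1 ≤ i → i ≤ j → j ≤ k → k ≤ l.length →
      v ∈ cliqueAt ∅ ∅ l i → v ∈ cliqueAt ∅ ∅ l k → v ∈ cliqueAt ∅ ∅ l j

/-- `T` is a PQ-tree of `H`: its leaves are the maximal cliques of `H`, and its admissible orders
are precisely the consecutive orderings of the maximal cliques. -/
def IsPQTreeOf (H : G.Subgraph) (T : PQTree (Set V)) : Prop :=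
  T.Proper ∧ ∀ l, T.Admissible l ↔ IsConsecutive H l

/-- No ambiguous simple component `I` has `C(I) = C(S)` for a minimal sector `S` of an interval
model of `H`. In a model with the maximal cliques `𝕃₁, …, 𝕃ₙ` from left to right, the minimal
sectors are the `n + 1` gaps before, between and after the maximal sectors, and their cliques are
`C(𝕃ᵢ) ∩ C(𝕃ᵢ₊₁)` for `0 ≤ i ≤ n`, where `C(𝕃₀) = C(𝕃ₙ₊₁) = ∅`. -/
def NoSimpleOnMinimalSector (C : Set V) (H : G.Subgraph) : Prop :=
  ∀ I : Comp G C, IsAmbiguous I → IsSimple I → ∀ l, IsConsecutive H l → ∀ i ≤ l.length,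
    cl I ≠ cliqueAt ∅ ∅ l i ∩ cliqueAt ∅ ∅ l (i + 1)

/-- Distinct ambiguous simple components have distinct sets `C(I)`; equivalently, `⊏` is a strict
partial order on the ambiguous components. -/
def SimpleDistinct (G : SimpleGraph V) (C : Set V) : Prop :=
  ∀ I J : Comp G C, IsAmbiguous I → IsSimple I → IsAmbiguous J → IsSimple J → cl I = cl J → I = J

/-- `A ≺ B` for sets of components. -/
def SetPrec (prec : Comp G C → Comp G C → Prop) (A B : Set (Comp G C)) : Prop :=
  ∀ I ∈ A, ∀ J ∈ B, prec I J

/-- `prec` is a strict linear order on `K`. -/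
def IsStrictLinearOn (K : Set (Comp G C)) (prec : Comp G C → Comp G C → Prop) : Prop :=
  (∀ I ∈ K, ¬ prec I I) ∧
  (∀ I ∈ K, ∀ J ∈ K, ∀ J' ∈ K, prec I J → prec J J' → prec I J') ∧
  (∀ I ∈ K, ∀ J ∈ K, I ≠ J → prec I J ∨ prec J I)

/-- `inner^K(𝕃)`, where `M = C(𝕃)`: the components `I ∈ 𝓘' ∩ K` with `C(I) = M`. -/
def inner (H : G.Subgraph) (K : Set (Comp G C)) (M : Set V) : Set (Comp G C) :=
  {I | I ∉ deleted G C H ∧ cl I = M} ∩ K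

/-- `(K, prec)` is nice to the node `N` and induces the order `l` of its leaves. -/
structure IsNice (H : G.Subgraph) (N : PQTree (Set V)) (K : Set (Comp G C))
    (prec : Comp G C → Comp G C → Prop) (l : List (Set V)) : Prop where
  admissible : N.Admissible l
  nonempty : ∀ M ∈ l, (inner H K M).Nonempty
  interval : ∀ M ∈ l, ∀ I ∈ inner H K M, ∀ J ∈ K, ∀ I' ∈ inner H K M,
    prec I J → prec J I' → J ∈ inner H K M
  ordered : ∀ i j : ℕ, 1 ≤ i → i < j → j ≤ l.length →
    SetPrec prec (inner H K (cliqueAt ∅ ∅ l i)) (inner H K (cliqueAt ∅ ∅ l j))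

/-- `zone_L(𝕃ᵢ)`. -/
def zoneL (H : G.Subgraph) (K : Set (Comp G C)) (prec : Comp G C → Comp G C → Prop)
    (l : List (Set V)) (i : ℕ) : Set (Comp G C) :=
  {I | I ∈ K ∧ SetPrec prec {I} (inner H K (cliqueAt ∅ ∅ l i)) ∧
    (cl I ∩ (cliqueAt ∅ ∅ l i \ cliqueAt ∅ ∅ l (i - 1))).Nonempty}

/-- `zone_R(𝕃ᵢ)`. -/
def zoneR (H : G.Subgraph) (K : Set (Comp G C)) (prec : Comp G C → Comp G C → Prop)
    (l : List (Set V)) (i : ℕ) : Set (Comp G C) :=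
  {I | I ∈ K ∧ SetPrec prec (inner H K (cliqueAt ∅ ∅ l i)) {I} ∧
    (cl I ∩ (cliqueAt ∅ ∅ l i \ cliqueAt ∅ ∅ l (i + 1))).Nonempty}

/-- `zone(𝕃ᵢ)`. -/
def zone (H : G.Subgraph) (K : Set (Comp G C)) (prec : Comp G C → Comp G C → Prop)
    (l : List (Set V)) (i : ℕ) : Set (Comp G C) :=
  zoneL H K prec l i ∪ inner H K (cliqueAt ∅ ∅ l i) ∪ zoneR H K prec l i

/-- `D` is `C(I')` for the `⊑`-maximum `I'` of `Z` if `Z` is nonempty, and `B` if `Z` is empty. -/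
def IsSideClique (Z : Set (Comp G C)) (B D : Set V) : Prop :=
  (∃ I' ∈ Z, (∀ J ∈ Z, sqLE J I') ∧ D = cl I') ∨ (Z = ∅ ∧ D = B)

/-- `(K, prec)` is good for the node `N` and the borders `(BL, BR)`. -/
def IsGoodOrder (H : G.Subgraph) (N : PQTree (Set V)) (BL BR : Set V) (K : Set (Comp G C))
    (prec : Comp G C → Comp G C → Prop) : Prop :=
  K ⊆ (deleted G C H)ᶜ ∧ IsStrictLinearOn K prec ∧
  ∃ l : List (Set V), IsNice H N K prec l ∧
    -- the zones partition `K` and are ordered as the leaves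
    ((∀ i, 1 ≤ i → i ≤ l.length → (zone H K prec l i).Nonempty) ∧
      (∀ i j, 1 ≤ i → i < j → j ≤ l.length →
        Disjoint (zone H K prec l i) (zone H K prec l j)) ∧
      (∀ I, I ∈ K ↔ ∃ i, 1 ≤ i ∧ i ≤ l.length ∧ I ∈ zone H K prec l i) ∧
      (∀ i j, 1 ≤ i → i < j → j ≤ l.length →
        SetPrec prec (zone H K prec l i) (zone H K prec l j))) ∧
    ∀ i, 1 ≤ i → i ≤ l.length →
      -- left and right zones
      (RespectsBorder (zoneL H K prec l i) (cliqueAt BL BR l (i - 1) ∩ cliqueAt BL BR l i) ∧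
        ∀ I ∈ zoneL H K prec l i, ∀ J ∈ zoneL H K prec l i, (sqLT I J ↔ prec I J)) ∧
      (RespectsBorder (zoneR H K prec l i) (cliqueAt BL BR l i ∩ cliqueAt BL BR l (i + 1)) ∧
        ∀ I ∈ zoneR H K prec l i, ∀ J ∈ zoneR H K prec l i, (sqLT I J ↔ prec J I)) ∧
      -- maximal sectors with at least two components
      ((inner H K (cliqueAt BL BR l i)).Nontrivial →
        ∃ IL ∈ inner H K (cliqueAt BL BR l i), ∃ IR ∈ inner H K (cliqueAt BL BR l i),
          (∀ J ∈ inner H K (cliqueAt BL BR l i), J ≠ IL → prec IL J) ∧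
          (∀ J ∈ inner H K (cliqueAt BL BR l i), J ≠ IR → prec J IR) ∧
          (∀ J ∈ inner H K (cliqueAt BL BR l i), IsAmbiguous J) ∧
          (inner H K (cliqueAt BL BR l i) \ {IL, IR} = ∅ ∨
            ∃ J, inner H K (cliqueAt BL BR l i) \ {IL, IR} = {J} ∧ IsAmbiguous J ∧ IsSimple J) ∧
          (∀ J ∈ zoneL H K prec l i, sqLT J IL) ∧
          RespectsBorder (zoneL H K prec l i ∪ {IL})
            (cliqueAt BL BR l (i - 1) ∩ cliqueAt BL BR l i) ∧
          (∀ J ∈ zoneR H K prec l i, sqLT J IR) ∧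
          RespectsBorder (zoneR H K prec l i ∪ {IR})
            (cliqueAt BL BR l i ∩ cliqueAt BL BR l (i + 1))) ∧
      -- maximal sectors with exactly one component
      (∀ IS, inner H K (cliqueAt BL BR l i) = {IS} →
        ∃ CL CR : Set V,
          IsSideClique (zoneL H K prec l i)
            (cliqueAt BL BR l (i - 1) ∩ cliqueAt BL BR l i) CL ∧
          IsSideClique (zoneR H K prec l i)
            (cliqueAt BL BR l i ∩ cliqueAt BL BR l (i + 1)) CR ∧
          IsCliqueOf H CL ∧ IsCliqueOf H CR ∧
          nbr IS \ strongNbr IS ⊆ (C \ CL) ∪ (C \ CR) ∧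
          IsCircularArc (extGraph CL IS CR))

end Orders

end CenteredLollipop

/-! Cut the circle open at `P`. A vertex outside `C` covers a (possibly empty) interval of it, and a
vertex of `C` misses one (`ordConnected_trace`, `ordConnected_compl_trace`). Hence the components on
the circle occupy disjoint intervals and are linearly ordered. If `I ≺ J ≺ L`, a vertex of `C`
missing a point of `I` and a point of `L` misses all of `J`, so `cl I ∩ cl L ⊆ clStrong J`
(`mem_clStrong_of_between`). This inclusion carries nearly all of the argument. `IsSweep` records it
together with two criteria for ambiguity and the description of `H`; as `IsSweep` is invariant under
reversal, one-sided statements are proved for the left only.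

A Helly argument (`IsSweep.inner_nonempty`) realizes every maximal clique as `cl I`. The components
with a given maximal clique form an interval, and the resulting order of the cliques is consecutive,
hence admissible. A component in a zone of the leaf with clique `M` has `cl I ⊆ M`, so zones are
chains. A component between two neighbouring leaves and in neither of their zones would be simple
with clique `B_i`, which assumption (b) forbids. Components strictly inside `inner` are simple with
the same clique, so assumption (a) leaves at most one.

The last condition is geometric: `isCircularArc_extGraph` cuts a circular-arc model of the extended
graph out of the given model. -/

namespace CenteredLollipop

/-! ### Connected subgraphs of paths and cycles -/

/-- Discrete intermediate value principle: the convexity proofs below exhibit an edge crossing a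
boundary and rule it out. -/
theorem exists_adj_of_induce_connected {W : Type*} {X : SimpleGraph W} {S A : Set W}
    (h : (X.induce S).Connected) {a b : W} (ha : a ∈ S) (haA : a ∈ A) (hb : b ∈ S)
    (hbA : b ∉ A) : ∃ x y, x ∈ S ∧ x ∈ A ∧ y ∈ S ∧ y ∉ A ∧ X.Adj x y := by
  obtain ⟨w⟩ := h.preconnected ⟨a, ha⟩ ⟨b, hb⟩
  obtain ⟨d, -, h1, h2⟩ := w.exists_boundary_dart (Subtype.val ⁻¹' A) haA hbA
  exact ⟨d.fst, d.snd, d.fst.2, h1, d.snd.2, h2, d.adj⟩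

theorem cycleGraph_adj_cases {n : ℕ} {x y : Fin (n + 3)} (h : (cycleGraph (n + 3)).Adj x y)
    (hxy : x < y) : (y : ℕ) = x + 1 ∨ ((x : ℕ) = 0 ∧ (y : ℕ) = n + 2) := by
  rw [cycleGraph_adj'] at h
  have h1 := Fin.sub_val_of_le hxy.le
  have h2 := Fin.val_sub x y
  have h3 : (x : ℕ) < y := hxy
  rcases h with h | h
  · right
    rw [h2, Nat.mod_eq_of_lt (by omega)] at h
    omega
  · left
    omega

theorem induce_pathGraph_connected {n : ℕ} {S : Set (Fin n)} (hS : S.OrdConnected)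
    (hne : S.Nonempty) : ((pathGraph n).induce S).Connected := by
  have key : ∀ (d : ℕ) (x y : Fin n) (hx : x ∈ S) (hy : y ∈ S), (y : ℕ) = x + d →
      ((pathGraph n).induce S).Reachable ⟨x, hx⟩ ⟨y, hy⟩ := by
    intro d
    induction d with
    | zero =>
      intro x y hx hy h
      obtain rfl : y = x := Fin.ext h
      rfl
    | succ d ih =>
      intro x y hx hy h
      have hz : (⟨x + d, by omega⟩ : Fin n) ∈ S :=
        hS.out hx hy ⟨Fin.le_def.2 (by simp), Fin.le_def.2 (by simp; omega)⟩
      refine (ih x _ hx hz rfl).trans (Adj.reachable ?_)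
      rw [comap_adj, pathGraph_adj]
      left
      simp
      omega
  have : Nonempty S := hne.to_subtype
  refine ⟨fun ⟨x, hx⟩ ⟨y, hy⟩ ↦ ?_⟩
  rcases le_total (x : ℕ) y with h | h
  · exact key (y - x) x y hx hy (by omega)
  · exact (key (x - y) y x hy hx (by omega)).symm

theorem induce_cycleGraph_connected {n : ℕ} {S : Set (Fin n)} (hS : S.OrdConnected)
    (hne : S.Nonempty) : ((cycleGraph n).induce S).Connected :=
  (induce_pathGraph_connected hS hne).mono (comap_monotone _ pathGraph_le_cycleGraph)

/-- The complement is an initial segment containing `0` and a possibly empty final segment; the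
closing edge of the cycle joins them. -/
theorem induce_cycleGraph_compl_connected {n : ℕ} {W : Set (Fin (n + 3))} (hW : W.OrdConnected)
    (h0 : 0 ∉ W) : ((cycleGraph (n + 3)).induce Wᶜ).Connected := by
  have hpos : ∀ w ∈ W, 0 < w := fun w hw ↦ Fin.pos_iff_ne_zero.2 fun h ↦ h0 (h ▸ hw)
  set A : Set (Fin (n + 3)) := {x | ∀ w ∈ W, x < w}
  set B : Set (Fin (n + 3)) := {x | ∀ w ∈ W, w < x}
  have hAB : Wᶜ = A ∪ B := by
    ext x
    constructor
    · intro hx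
      by_contra hcon
      simp only [A, B, Set.mem_union, Set.mem_ofPred_eq, not_or, not_forall, not_lt] at hcon
      obtain ⟨⟨w, hw, hwx⟩, w', hw', hxw⟩ := hcon
      exact hx (hW.out hw hw' ⟨hwx, hxw⟩)
    · rintro (h | h) hx
      · exact lt_irrefl _ (h x hx)
      · exact lt_irrefl _ (h x hx)
  have hA : A.OrdConnected := ⟨fun x _ y hy z hz w hw ↦ hz.2.trans_lt (hy w hw)⟩
  have hB : B.OrdConnected := ⟨fun x hx y _ z hz w hw ↦ (hx w hw).trans_le hz.1⟩
  have hA0 : (0 : Fin (n + 3)) ∈ A := hpos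
  have hAc := induce_cycleGraph_connected hA ⟨0, hA0⟩
  rw [hAB]
  rcases B.eq_empty_or_nonempty with hB0 | ⟨b, hb⟩
  · rwa [hB0, Set.union_empty]
  · have hl : Fin.last (n + 2) ∈ B := fun w hw ↦ (hb w hw).trans_le (Fin.le_last b)
    refine connected_induce_union hAc.preconnected
      (induce_cycleGraph_connected hB ⟨b, hb⟩).preconnected hA0 hl ?_
    rw [cycleGraph_adj']
    left
    rw [Fin.val_sub]
    simp

/-! ### Traces on the circle -/

section Trace

variable {V : Type*} {G : SimpleGraph V} {C : Set V} {H : G.Subgraph} {m s : ℕ}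
  {φ : V → Set (Fin (m + 3) ⊕ Fin (s + 1))}

/-- The part of `φ v` on the circle. -/
def trace (φ : V → Set (Fin (m + 3) ⊕ Fin (s + 1))) (v : V) : Set (Fin (m + 3)) :=
  {i | Sum.inl i ∈ φ v}

/-- The part of the circle covered by the vertices of the component `I`. -/
def region (φ : V → Set (Fin (m + 3) ⊕ Fin (s + 1))) (I : Comp G C) : Set (Fin (m + 3)) :=
  {i | ∃ u ∈ verts I, i ∈ trace φ u}

theorem notMem_of_mem_verts {I : Comp G C} {u : V} (hu : u ∈ verts I) : u ∉ C := by
  obtain ⟨x, -, rfl⟩ := hu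
  exact x.2

theorem verts_nonempty (I : Comp G C) : (verts I).Nonempty :=
  I.nonempty_supp.image _

theorem eq_of_adj_of_mem_verts {I J : Comp G C} {u w : V} (hu : u ∈ verts I) (hw : w ∈ verts J)
    (h : G.Adj u w) : I = J := by
  obtain ⟨x, hx, rfl⟩ := hu
  obtain ⟨y, hy, rfl⟩ := hw
  rw [ConnectedComponent.mem_supp_iff] at hx hy
  rw [← hx, ← hy]
  exact ConnectedComponent.connectedComponentMk_eq_of_adj h

theorem eq_of_mem_verts {I J : Comp G C} {u : V} (hu : u ∈ verts I) (hw : u ∈ verts J) :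
    I = J := by
  obtain ⟨x, hx, rfl⟩ := hu
  obtain ⟨y, hy, hxy⟩ := hw
  obtain rfl := Subtype.ext hxy
  rw [ConnectedComponent.mem_supp_iff] at hx hy
  rw [← hx, ← hy]

theorem exists_adj_of_mem_verts {I : Comp G C} {A : Set V} {a b : V} (ha : a ∈ verts I)
    (haA : a ∈ A) (hb : b ∈ verts I) (hbA : b ∉ A) :
    ∃ x y, x ∈ verts I ∧ x ∈ A ∧ y ∈ verts I ∧ y ∉ A ∧ G.Adj x y := by
  obtain ⟨a, ha, rfl⟩ := ha
  obtain ⟨b, hb, rfl⟩ := hb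
  obtain ⟨x, y, h1, h2, h3, h4, h5⟩ := exists_adj_of_induce_connected
    (A := Subtype.val ⁻¹' A) I.connected_toSimpleGraph ha haA hb hbA
  exact ⟨x, y, ⟨x, h1, rfl⟩, h2, ⟨y, h3, rfl⟩, h4, h5⟩

theorem lollipop_adj_inl_inl {x y : Fin (m + 3)}
    (h : (lollipop m s).Adj (Sum.inl x) (Sum.inl y)) : (cycleGraph (m + 3)).Adj x y := by
  simpa [lollipop, edge_adj] using h

theorem lollipop_adj_inl_inr {x : Fin (m + 3)} {y : Fin (s + 1)}
    (h : (lollipop m s).Adj (Sum.inl x) (Sum.inr y)) : x = 0 := by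
  have : x = 0 ∧ y = 0 := by simpa [lollipop, edge_adj] using h
  exact this.1

theorem clStrong_subset_cl (I : Comp G C) : clStrong I ⊆ cl I := by
  rintro v ⟨hv, hn⟩
  refine ⟨hv, fun hs ↦ ?_⟩
  obtain ⟨u, hu⟩ := verts_nonempty I
  exact hn ⟨hv, u, hu, hs.2 u hu⟩

namespace IsCenteredModel

variable (hφ : IsCenteredModel G C H φ)

include hφ

theorem zero_mem_trace {v : V} : 0 ∈ trace φ v ↔ v ∈ C := hφ.center v

/-- An edge leaving the part of the circle below `k` ends at `k` or starts at `P`. The vertex misses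
`k` by assumption and `P` because it is outside `C`. -/
theorem ordConnected_trace {v : V} (hv : v ∉ C) : (trace φ v).OrdConnected := by
  refine ⟨fun i hi j hj k hk ↦ ?_⟩
  by_contra hkt
  have hik : i < k := lt_of_le_of_ne hk.1 fun h ↦ hkt (h ▸ hi)
  have hkj : k < j := lt_of_le_of_ne hk.2 fun h ↦ hkt (h ▸ hj)
  obtain ⟨x, y, h1, ⟨x, hx, rfl⟩, h3, h4, h5⟩ := exists_adj_of_induce_connected
    (hφ.model.connected v) (A := Sum.inl '' {x | x < k}) hi ⟨i, hik, rfl⟩ hj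
    (by rintro ⟨x, hx, h⟩; exact lt_asymm hkj (Sum.inl_injective h ▸ hx))
  have hx0 : x ≠ 0 := by
    rintro rfl
    exact hv (hφ.zero_mem_trace.1 h1)
  rcases y with y | y
  · have hky : k < y := by
      rcases lt_trichotomy y k with h | rfl | h
      · exact (h4 ⟨y, h, rfl⟩).elim
      · exact (hkt h3).elim
      · exact h
    have hx : x < k := hx
    rw [Fin.lt_def] at hx hky
    rcases cycleGraph_adj_cases (lollipop_adj_inl_inl h5) (Fin.lt_def.2 (hx.trans hky)) with h | h
    · omega
    · exact hx0 (Fin.ext h.1)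
  · exact hx0 (lollipop_adj_inl_inr h5)

/-- If `i` and `j` are missed, a covered point between them is cut off from `P`, which the connected
set of `v` contains. -/
theorem ordConnected_compl_trace {v : V} (hv : v ∈ C) : (trace φ v)ᶜ.OrdConnected := by
  refine ⟨fun i hi j hj k hk hkt ↦ ?_⟩
  have hik : i < k := lt_of_le_of_ne hk.1 fun h ↦ hi (h ▸ hkt)
  have hkj : k < j := lt_of_le_of_ne hk.2 fun h ↦ hj (h ▸ hkt)
  obtain ⟨x, y, h1, ⟨x, ⟨hx, hx'⟩, rfl⟩, h3, h4, h5⟩ := exists_adj_of_induce_connected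
    (hφ.model.connected v) (A := Sum.inl '' {x | i < x ∧ x < j}) hkt ⟨k, ⟨hik, hkj⟩, rfl⟩
    (hφ.zero_mem_trace.2 hv)
    (by rintro ⟨x, hx, h⟩
        exact (Fin.not_lt_zero i) (Sum.inl_injective h ▸ hx.1))
  rcases y with y | y
  · have hyi : y ≠ i := fun h ↦ hi (h ▸ h3)
    have hyj : y ≠ j := fun h ↦ hj (h ▸ h3)
    have hy : y < i ∨ j < y := by
      by_contra hcon
      push Not at hcon
      exact h4 ⟨y, ⟨lt_of_le_of_ne hcon.1 hyi.symm, lt_of_le_of_ne hcon.2 hyj⟩, rfl⟩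
    have hadj := lollipop_adj_inl_inl h5
    simp only [Fin.lt_def] at hx hx' hy
    rcases hy with hy | hy
    · have := cycleGraph_adj_cases hadj.symm (Fin.lt_def.2 (hy.trans hx))
      omega
    · have := cycleGraph_adj_cases hadj (Fin.lt_def.2 (hx'.trans hy))
      omega
  · rw [lollipop_adj_inl_inr h5] at hx
    exact Fin.not_lt_zero i hx

theorem trace_nonempty {I : Comp G C} (hI : I ∈ onCircle C φ) {u : V} (hu : u ∈ verts I) :
    (trace φ u).Nonempty := by
  obtain ⟨⟨x, hx⟩⟩ := (hφ.model.connected u).nonempty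
  obtain ⟨i, rfl⟩ := hI u hu hx
  exact ⟨i, hx⟩

theorem region_nonempty {I : Comp G C} (hI : I ∈ onCircle C φ) : (region φ I).Nonempty := by
  obtain ⟨u, hu⟩ := verts_nonempty I
  obtain ⟨i, hi⟩ := hφ.trace_nonempty hI hu
  exact ⟨i, u, hu, hi⟩

theorem adj_iff_of_mem_verts {I : Comp G C} (hI : I ∈ onCircle C φ) {u v : V} (hu : u ∈ verts I)
    (huv : v ≠ u) : G.Adj v u ↔ (trace φ v ∩ trace φ u).Nonempty := by
  rw [hφ.model.adj_iff v u huv]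
  constructor
  · rintro ⟨x, hv, hx⟩
    obtain ⟨i, rfl⟩ := hI u hu hx
    exact ⟨i, hv, hx⟩
  · rintro ⟨i, hv, hx⟩
    exact ⟨_, hv, hx⟩

theorem disjoint_region {I J : Comp G C} (hI : I ∈ onCircle C φ) (hIJ : I ≠ J) :
    Disjoint (region φ I) (region φ J) := by
  rw [Set.disjoint_left]
  rintro i ⟨u, hu, hi⟩ ⟨w, hw, hj⟩
  refine hIJ (eq_of_adj_of_mem_verts hw hu ?_).symm
  rw [hφ.adj_iff_of_mem_verts hI hu fun h ↦ hIJ (eq_of_mem_verts hu (h ▸ hw))]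
  exact ⟨i, hj, hi⟩

/-- If `k` were an uncovered gap, every vertex of `I` would lie entirely on one side of it, and no
edge of the connected `I` could join the two sides. -/
theorem ordConnected_region {I : Comp G C} (hI : I ∈ onCircle C φ) :
    (region φ I).OrdConnected := by
  refine ⟨fun i ⟨u, hu, hi⟩ j ⟨w, hw, hj⟩ k hk ↦ ?_⟩
  by_contra hkt
  have hlt : ∀ x ∈ verts I, (∃ a ∈ trace φ x, a < k) → ∀ b ∈ trace φ x, b < k := by
    rintro x hx ⟨a, ha, hak⟩ b hb
    by_contra! hkb
    exact hkt ⟨x, hx, (hφ.ordConnected_trace (notMem_of_mem_verts hx)).out ha hb ⟨hak.le, hkb⟩⟩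
  have hik : i < k := lt_of_le_of_ne hk.1 fun h ↦ hkt (h ▸ ⟨u, hu, hi⟩)
  obtain ⟨x, y, h1, h2, h3, h4, h5⟩ := exists_adj_of_mem_verts hu
    (A := {x | ∃ a ∈ trace φ x, a < k}) ⟨i, hi, hik⟩ hw
    (fun h ↦ (hlt w hw h j hj).not_ge hk.2)
  obtain ⟨a, ha, ha'⟩ := (hφ.adj_iff_of_mem_verts hI h3 h5.ne).1 h5
  exact h4 ⟨a, ha', hlt x h1 h2 a ha⟩

theorem mem_cl_iff {I : Comp G C} (hI : I ∈ onCircle C φ) {v : V} :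
    v ∈ cl I ↔ v ∈ C ∧ ∃ u ∈ verts I, trace φ u ⊆ (trace φ v)ᶜ := by
  simp only [cl, strongNbr, Set.mem_sdiff, Set.mem_ofPred_eq, not_and, not_forall]
  refine and_congr_right fun hv ↦ ?_
  simp only [hv, true_imp_iff, exists_prop]
  refine exists_congr fun u ↦ and_congr_right fun hu ↦ ?_
  rw [hφ.adj_iff_of_mem_verts hI hu fun h ↦ notMem_of_mem_verts hu (h ▸ hv),
    Set.not_nonempty_iff_eq_empty, ← Set.disjoint_iff_inter_eq_empty,
    Set.subset_compl_iff_disjoint_left]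

theorem mem_clStrong_iff {I : Comp G C} (hI : I ∈ onCircle C φ) {v : V} :
    v ∈ clStrong I ↔ v ∈ C ∧ region φ I ⊆ (trace φ v)ᶜ := by
  simp only [clStrong, nbr, Set.mem_sdiff, Set.mem_ofPred_eq, not_and, not_exists]
  refine and_congr_right fun hv ↦ ?_
  simp only [hv, true_imp_iff]
  constructor
  · rintro h i ⟨u, hu, hi⟩ hi'
    exact h u hu ((hφ.adj_iff_of_mem_verts hI hu
      fun h ↦ notMem_of_mem_verts hu (h ▸ hv)).2 ⟨i, hi', hi⟩)
  · intro h u hu hadj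
    obtain ⟨i, hi', hi⟩ := (hφ.adj_iff_of_mem_verts hI hu
      fun h ↦ notMem_of_mem_verts hu (h ▸ hv)).1 hadj
    exact h ⟨u, hu, hi⟩ hi'

end IsCenteredModel

end Trace

/-! ### Order of the components on the circle -/

theorem forall_lt_or_forall_lt {α : Type*} [LinearOrder α] {S T : Set α} (hS : S.OrdConnected)
    (hT : T.OrdConnected) (hd : Disjoint S T) (hSn : S.Nonempty) (hTn : T.Nonempty) :
    (∀ i ∈ S, ∀ j ∈ T, i < j) ∨ (∀ j ∈ T, ∀ i ∈ S, j < i) := by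
  rw [Set.disjoint_left] at hd
  have aux : ∀ {S T : Set α}, S.OrdConnected → T.OrdConnected → (∀ x ∈ S, x ∉ T) →
      ∀ i ∈ S, ∀ j ∈ T, i < j → ∀ i' ∈ S, ∀ j' ∈ T, i' < j' := by
    intro S T hS hT hd i hi j hj hij i' hi' j' hj'
    by_contra! h
    rcases le_total i j' with h' | h'
    · exact hd _ (hS.out hi hi' ⟨h', h⟩) hj'
    · exact hd _ hi (hT.out hj' hj ⟨h', hij.le⟩)
  obtain ⟨i, hi⟩ := hSn
  obtain ⟨j, hj⟩ := hTn
  rcases lt_trichotomy i j with h | rfl | h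
  · exact Or.inl (aux hS hT hd i hi j hj h)
  · exact (hd hi hj).elim
  · exact Or.inr (aux hT hS (fun x h h' ↦ hd h' h) j hj i hi h)

theorem ordConnected_image_succ {n : ℕ} {S : Set (Fin n)} (hS : S.OrdConnected) :
    (Fin.succ '' S).OrdConnected := by
  refine ⟨?_⟩
  rintro _ ⟨x, hx, rfl⟩ _ ⟨y, hy, rfl⟩ z hz
  have hz0 : z ≠ 0 := by
    rintro rfl
    exact (Fin.succ_pos x).not_ge hz.1
  obtain ⟨w, rfl⟩ := Fin.exists_succ_eq.2 hz0
  exact ⟨w, hS.out hx hy ⟨Fin.succ_le_succ_iff.1 hz.1, Fin.succ_le_succ_iff.1 hz.2⟩, rfl⟩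

theorem ordConnected_image_rev {n : ℕ} {S : Set (Fin n)} (hS : S.OrdConnected) :
    (Fin.rev '' S).OrdConnected := by
  refine ⟨?_⟩
  rintro _ ⟨x, hx, rfl⟩ _ ⟨y, hy, rfl⟩ z hz
  exact ⟨z.rev, hS.out hy hx ⟨Fin.le_rev_iff.1 hz.2, Fin.rev_le_iff.1 hz.1⟩, Fin.rev_rev z⟩

section Geometry

variable {V : Type*} {G : SimpleGraph V} {C : Set V} {H : G.Subgraph} {m s : ℕ}
  {φ : V → Set (Fin (m + 3) ⊕ Fin (s + 1))}

theorem precModel_iff {I J : Comp G C} :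
    precModel φ I J ↔ ∀ i ∈ region φ I, ∀ j ∈ region φ J, i < j :=
  ⟨fun h i ⟨u, hu, hi⟩ j ⟨w, hw, hj⟩ ↦ h u hu w hw i j hi hj,
    fun h u hu w hw i j hi hj ↦ h i ⟨u, hu, hi⟩ j ⟨w, hw, hj⟩⟩

namespace IsCenteredModel

variable (hφ : IsCenteredModel G C H φ)

include hφ

theorem isStrictLinearOn : IsStrictLinearOn (onCircle C φ : Set (Comp G C)) (precModel φ) := by
  refine ⟨fun I hI h ↦ ?_, fun I hI J hJ L hL h h' ↦ ?_, fun I hI J hJ hne ↦ ?_⟩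
  · obtain ⟨i, hi⟩ := hφ.region_nonempty hI
    exact lt_irrefl _ (precModel_iff.1 h i hi i hi)
  · obtain ⟨j, hj⟩ := hφ.region_nonempty hJ
    exact precModel_iff.2 fun i hi k hk ↦
      (precModel_iff.1 h i hi j hj).trans (precModel_iff.1 h' j hj k hk)
  · simp only [precModel_iff]
    exact forall_lt_or_forall_lt (hφ.ordConnected_region hI) (hφ.ordConnected_region hJ)
      (hφ.disjoint_region hI hne) (hφ.region_nonempty hI) (hφ.region_nonempty hJ)

theorem exists_mem_region_of_mem_cl {I : Comp G C} (hI : I ∈ onCircle C φ) {v : V}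
    (hv : v ∈ cl I) : ∃ i ∈ region φ I, i ∉ trace φ v := by
  obtain ⟨-, u, hu, h⟩ := (hφ.mem_cl_iff hI).1 hv
  obtain ⟨i, hi⟩ := hφ.trace_nonempty hI hu
  exact ⟨i, ⟨u, hu, hi⟩, h hi⟩

/-- The missed set of `v` is convex and has points in the regions of `I` and `L`, hence contains the
region of `J` between them. -/
theorem mem_clStrong_of_between {I J L : Comp G C} (hI : I ∈ onCircle C φ) (hJ : J ∈ onCircle C φ)
    (hL : L ∈ onCircle C φ) (hIJ : precModel φ I J) (hJL : precModel φ J L) {v : V}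
    (hvI : v ∈ cl I) (hvL : v ∈ cl L) : v ∈ clStrong J := by
  obtain ⟨i, hi, hi'⟩ := hφ.exists_mem_region_of_mem_cl hI hvI
  obtain ⟨k, hk, hk'⟩ := hφ.exists_mem_region_of_mem_cl hL hvL
  exact (hφ.mem_clStrong_iff hJ).2 ⟨hvI.1, fun j hj ↦ (hφ.ordConnected_compl_trace hvI.1).out
    hi' hk' ⟨(precModel_iff.1 hIJ i hi j hj).le, (precModel_iff.1 hJL j hj k hk).le⟩⟩

/-- Within the region of `I`, the points missed by `v` are up-closed, because `v` also misses a
point of `J` further right. -/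
theorem notMem_trace_of_precModel_right {I J : Comp G C} (hJ : J ∈ onCircle C φ)
    (hIJ : precModel φ I J) {v : V} (hv : v ∈ cl J) {i k : Fin (m + 3)}
    (hi : i ∉ trace φ v) (hk : k ∈ region φ I) (hik : i ≤ k) : k ∉ trace φ v := by
  obtain ⟨j, hj, hj'⟩ := hφ.exists_mem_region_of_mem_cl hJ hv
  exact (hφ.ordConnected_compl_trace hv.1).out hi hj' ⟨hik, (precModel_iff.1 hIJ k hk j hj).le⟩

theorem notMem_trace_of_precModel_left {I J : Comp G C} (hJ : J ∈ onCircle C φ)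
    (hJI : precModel φ J I) {v : V} (hv : v ∈ cl J) {i k : Fin (m + 3)}
    (hi : i ∉ trace φ v) (hk : k ∈ region φ I) (hki : k ≤ i) : k ∉ trace φ v := by
  obtain ⟨j, hj, hj'⟩ := hφ.exists_mem_region_of_mem_cl hJ hv
  exact (hφ.ordConnected_compl_trace hv.1).out hj' hi ⟨(precModel_iff.1 hJI j hj k hk).le, hki⟩

theorem adj_of_mem_center {u v : V} (hu : u ∈ C) (hv : v ∈ C) (huv : u ≠ v) : G.Adj u v :=
  (hφ.model.adj_iff u v huv).2 ⟨_, (hφ.center u).2 hu, (hφ.center v).2 hv⟩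

/-- If the vertices of `cl I` miss up-closed parts of the region of `I` (for the order of the circle
or its reverse, according to `e`), then `I` is ambiguous. -/
theorem isAmbiguous_of_monotone {I : Comp G C} (hI : I ∈ onCircle C φ)
    (e : Equiv.Perm (Fin (m + 3)))
    (he : ∀ S : Set (Fin (m + 3)), S.OrdConnected → (e '' S).OrdConnected)
    (h : ∀ v ∈ cl I, ∀ i ∈ region φ I, ∀ j ∈ region φ I, e i ≤ e j →
      i ∉ trace φ v → j ∉ trace φ v) : IsAmbiguous I := by
  classical
  -- The path is the cut circle, rearranged by `e`, with a new first point `0` for the clique `C`. A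
  -- vertex of `C` extends from `0` to the last point of the region that it covers; up-closedness of
  -- the missed part ensures that nothing missed is swallowed.
  let ψ : V → Set (Fin (m + 3 + 1)) := fun v ↦
    if v ∈ C then {x | x = 0 ∨ ∃ j ∈ region φ I, j ∈ trace φ v ∧ x ≤ (e j).succ}
    else Fin.succ '' (e '' trace φ v)
  have hψC : ∀ {v x}, v ∈ C → (x ∈ ψ v ↔ x = 0 ∨
      ∃ j ∈ region φ I, j ∈ trace φ v ∧ x ≤ (e j).succ) := by
    intro v x hv
    simp [ψ, hv]
  have hψI : ∀ {v}, v ∈ verts I → ψ v = Fin.succ '' (e '' trace φ v) := by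
    intro v hv
    simp [ψ, notMem_of_mem_verts hv]
  have hCI : ∀ v ∈ C, ∀ u ∈ verts I, (G.Adj v u ↔ (ψ v ∩ ψ u).Nonempty) := by
    intro v hv u hu
    have huv : v ≠ u := fun h ↦ notMem_of_mem_verts hu (h ▸ hv)
    constructor
    · intro hadj
      obtain ⟨i, hi, hi'⟩ := (hφ.adj_iff_of_mem_verts hI hu huv).1 hadj
      refine ⟨(e i).succ, (hψC hv).2 (Or.inr ⟨i, ⟨u, hu, hi'⟩, hi, le_rfl⟩), ?_⟩
      rw [hψI hu]
      exact ⟨_, ⟨i, hi', rfl⟩, rfl⟩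
    · rintro ⟨x, hx, hx'⟩
      rw [hψI hu] at hx'
      obtain ⟨_, ⟨i, hi, rfl⟩, rfl⟩ := hx'
      by_contra hadj
      have hvcl : v ∈ cl I := ⟨hv, fun hs ↦ hadj (hs.2 u hu)⟩
      have hit : i ∉ trace φ v := fun hi' ↦
        hadj ((hφ.adj_iff_of_mem_verts hI hu huv).2 ⟨i, hi', hi⟩)
      rcases (hψC hv).1 hx with h0 | ⟨j, hj, hjv, hij⟩
      · exact Fin.succ_ne_zero _ h0
      · exact h v hvcl i ⟨u, hu, hi⟩ j hj (Fin.succ_le_succ_iff.1 hij) hit hjv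
  refine ⟨m + 3, fun v ↦ ψ v, ⟨?_, ?_⟩, ?_⟩
  · rintro ⟨v, hv | hv⟩
    · refine induce_pathGraph_connected (IsLowerSet.ordConnected ?_) ⟨0, (hψC hv).2 (Or.inl rfl)⟩
      intro x y hyx hx
      rcases (hψC hv).1 hx with rfl | ⟨j, hj, hjv, hxj⟩
      · exact (hψC hv).2 (Or.inl (Fin.le_zero_iff.1 hyx))
      · exact (hψC hv).2 (Or.inr ⟨j, hj, hjv, hyx.trans hxj⟩)
    · change ((pathGraph _).induce (ψ v)).Connected
      rw [hψI hv]
      exact induce_pathGraph_connected (ordConnected_image_succ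
        (he _ (hφ.ordConnected_trace (notMem_of_mem_verts hv))))
        (((hφ.trace_nonempty hI hv).image _).image _)
  · rintro ⟨u, hu⟩ ⟨v, hv⟩ huv
    replace huv : u ≠ v := fun h ↦ huv (Subtype.ext h)
    change G.Adj u v ↔ _
    rcases hu with hu | hu <;> rcases hv with hv | hv
    · exact iff_of_true (hφ.adj_of_mem_center hu hv huv)
        ⟨0, (hψC hu).2 (Or.inl rfl), (hψC hv).2 (Or.inl rfl)⟩
    · exact hCI u hu v hv
    · rw [adj_comm, Set.inter_comm]
      exact hCI v hv u hu
    · simp only [hψI hu, hψI hv]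
      rw [← Set.image_inter (Fin.succ_injective _), ← Set.image_inter e.injective,
        Set.image_nonempty, Set.image_nonempty, hφ.adj_iff_of_mem_verts hI hv huv]
  · rintro ⟨v, hv | hv⟩
    · exact iff_of_true ((hψC hv).2 (Or.inl rfl)) hv
    · refine iff_of_false ?_ (notMem_of_mem_verts hv)
      simp only [hψI hv]
      rintro ⟨x, -, hx⟩
      exact Fin.succ_ne_zero _ hx

theorem isAmbiguous_of_precModel {I J : Comp G C} (hI : I ∈ onCircle C φ) (hJ : J ∈ onCircle C φ)
    (hIJ : precModel φ I J) (hcl : cl I ⊆ cl J) : IsAmbiguous I :=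
  hφ.isAmbiguous_of_monotone hI 1 (fun S hS ↦ by simpa using hS) fun _ hv _ _ _ hj hij hi ↦
    hφ.notMem_trace_of_precModel_right hJ hIJ (hcl hv) hi hj hij

theorem isAmbiguous_of_precModel_symm {I J : Comp G C} (hI : I ∈ onCircle C φ)
    (hJ : J ∈ onCircle C φ) (hJI : precModel φ J I) (hcl : cl I ⊆ cl J) : IsAmbiguous I :=
  hφ.isAmbiguous_of_monotone hI Fin.revPerm (fun _ hS ↦ ordConnected_image_rev hS)
    fun _ hv _ _ _ hj hij hi ↦
      hφ.notMem_trace_of_precModel_left hJ hJI (hcl hv) hi hj (Fin.rev_le_rev.1 hij)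

/-- A vertex of `cl I` misses the whole region, so the monotonicity condition is trivial. -/
theorem isAmbiguous_of_isSimple {I : Comp G C} (hI : I ∈ onCircle C φ) (h : IsSimple I) :
    IsAmbiguous I :=
  hφ.isAmbiguous_of_monotone hI 1 (fun S hS ↦ by simpa using hS) fun v hv _ _ _ hj _ _ ↦ by
    rw [h] at hv
    exact ((hφ.mem_clStrong_iff hI).1 hv).2 hj

/-- The cycle has three more points: `0` plays the role of `P`, `1` is `v_L`, `m + 5` is `v_R`, and
`i + 2` copies the point `i`. A vertex of `C` receives the complement of the hull `W v` of the
points `B v` it has to miss. By `hL` and `hR`, members of `CL` and `CR` miss points of the model to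
the left and right of `I`. -/
theorem isCircularArc_extGraph {I : Comp G C} (hI : I ∈ onCircle C φ) {CL CR : Set V}
    (hL : ∀ v ∈ CL, ∃ J ∈ onCircle C φ, precModel φ J I ∧ v ∈ cl J)
    (hR : ∀ v ∈ CR, ∃ J ∈ onCircle C φ, precModel φ I J ∧ v ∈ cl J) :
    IsCircularArc (extGraph CL I CR) := by
  classical
  let B : V → Set (Fin (m + 3 + 3)) := fun v ↦ {y | ((y : ℕ) = 1 ∧ v ∈ CL) ∨
    ((y : ℕ) = m + 5 ∧ v ∈ CR) ∨ ∃ i ∈ region φ I, i ∉ trace φ v ∧ (y : ℕ) = i + 2}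
  let W : V → Set (Fin (m + 3 + 3)) := fun v ↦ {x | ∃ y ∈ B v, ∃ z ∈ B v, y ≤ x ∧ x ≤ z}
  let f : Fin (m + 3) → Fin (m + 3 + 3) := fun i ↦ ⟨i + 2, by omega⟩
  have hf : f.Injective := fun i j h ↦ Fin.ext (by simpa [f] using h)
  let pt : Bool → Fin (m + 3 + 3) := fun b ↦ if b then ⟨m + 5, by omega⟩ else ⟨1, by omega⟩
  have hBW : ∀ v, B v ⊆ W v := fun v y hy ↦ ⟨y, hy, y, hy, le_rfl, le_rfl⟩
  have hW : ∀ v, (W v).OrdConnected := fun v ↦ ⟨by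
    rintro x ⟨y, hy, -, -, hyx, -⟩ x' ⟨-, -, z, hz, -, hxz⟩ w hw
    exact ⟨y, hy, z, hz, hyx.trans hw.1, hw.2.trans hxz⟩⟩
  have hW0 : ∀ v, 0 ∉ W v := by
    rintro v ⟨y, hy, -, -, h, -⟩
    rw [Fin.le_zero_iff] at h
    subst h
    rcases hy with h | h | ⟨i, -, -, h⟩
    · simp at h
    · simp at h
    · simp at h
  have hWL : ∀ v, pt false ∈ W v ↔ v ∈ CL := by
    refine fun v ↦ ⟨?_, fun h ↦ hBW v (Or.inl ⟨rfl, h⟩)⟩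
    rintro ⟨y, hy, -, -, h, -⟩
    have h' : (y : ℕ) ≤ 1 := h
    rcases hy with hy | hy | ⟨i, -, -, hy⟩
    · exact hy.2
    · omega
    · omega
  have hWR : ∀ v, pt true ∈ W v ↔ v ∈ CR := by
    refine fun v ↦ ⟨?_, fun h ↦ hBW v (Or.inr (Or.inl ⟨rfl, h⟩))⟩
    rintro ⟨-, -, z, hz, -, h⟩
    have h' : m + 5 ≤ (z : ℕ) := h
    rcases hz with hz | hz | ⟨i, -, -, hz⟩
    · omega
    · exact hz.2
    · omega
  -- Taking the hull adds no covered point of the region: each endpoint of the hull corresponds to a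
  -- point missed in the model, in `I` or in a component on that side of it, and missed sets are
  -- convex.
  have hWf : ∀ v ∈ C, ∀ i ∈ region φ I, (f i ∈ W v ↔ i ∉ trace φ v) := by
    refine fun v hv i hi ↦ ⟨?_, fun h ↦ hBW v (Or.inr (Or.inr ⟨i, hi, h, rfl⟩))⟩
    rintro ⟨y, hy, z, hz, hyi, hiz⟩
    have hyi' : (y : ℕ) ≤ i + 2 := hyi
    have hiz' : (i : ℕ) + 2 ≤ z := hiz
    rcases hy with ⟨-, hvL⟩ | hy | ⟨j, hj, hjv, hy⟩
    · obtain ⟨J, hJ, hJI, hvJ⟩ := hL v hvL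
      rcases hz with hz | ⟨-, hvR⟩ | ⟨k, hk, hkv, hz⟩
      · omega
      · obtain ⟨J', hJ', hIJ', hvJ'⟩ := hR v hvR
        exact ((hφ.mem_clStrong_iff hI).1
          (hφ.mem_clStrong_of_between hJ hI hJ' hJI hIJ' hvJ hvJ')).2 hi
      · exact hφ.notMem_trace_of_precModel_left hJ hJI hvJ hkv hi (Fin.le_def.2 (by omega))
    · omega
    · have hji : j ≤ i := Fin.le_def.2 (by omega)
      rcases hz with hz | ⟨-, hvR⟩ | ⟨k, hk, hkv, hz⟩
      · omega
      · obtain ⟨J', hJ', hIJ', hvJ'⟩ := hR v hvR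
        exact hφ.notMem_trace_of_precModel_right hJ' hIJ' hvJ' hjv hi hji
      · exact (hφ.ordConnected_compl_trace hv).out hjv hkv ⟨hji, Fin.le_def.2 (by omega)⟩
  let ψ : V → Set (Fin (m + 3 + 3)) := fun v ↦ if v ∈ C then (W v)ᶜ else f '' trace φ v
  have hψC : ∀ {v}, v ∈ C → ψ v = (W v)ᶜ := fun hv ↦ if_pos hv
  have hψI : ∀ {v}, v ∈ verts I → ψ v = f '' trace φ v := fun hv ↦
    if_neg (notMem_of_mem_verts hv)
  have hCI : ∀ v ∈ C, ∀ u ∈ verts I, (G.Adj v u ↔ (ψ v ∩ ψ u).Nonempty) := by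
    intro v hv u hu
    rw [hφ.adj_iff_of_mem_verts hI hu fun h ↦ notMem_of_mem_verts hu (h ▸ hv), hψC hv, hψI hu]
    constructor
    · rintro ⟨i, hi, hi'⟩
      exact ⟨f i, fun h ↦ (hWf v hv i ⟨u, hu, hi'⟩).1 h hi, i, hi', rfl⟩
    · rintro ⟨_, hx, i, hi, rfl⟩
      refine ⟨i, ?_, hi⟩
      by_contra hcon
      exact hx ((hWf v hv i ⟨u, hu, hi⟩).2 hcon)
  have hb : ∀ (u : ↥(C ∪ verts I)) (b : Bool), (u.1 ∈ C \ (if b then CR else CL) ↔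
      (ψ u.1 ∩ {pt b}).Nonempty) := by
    rintro ⟨u, hu | hu⟩ b
    · rw [Set.inter_singleton_nonempty, hψC hu, Set.mem_compl_iff, Set.mem_sdiff]
      cases b
      · simp [hWL, hu]
      · simp [hWR, hu]
    · refine iff_of_false (fun h ↦ notMem_of_mem_verts hu h.1) ?_
      rw [Set.inter_singleton_nonempty, hψI hu]
      rintro ⟨i, -, hi⟩
      have := congrArg Fin.val hi
      cases b
      · simp [f, pt] at this
      · simp [f, pt] at this
        omega
  refine ⟨m + 3, Sum.elim (fun v ↦ ψ v) (fun b ↦ {pt b}), ?_, ?_⟩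
  · rintro (⟨v, hv | hv⟩ | b)
    · change ((cycleGraph _).induce (ψ v)).Connected
      rw [hψC hv]
      exact induce_cycleGraph_compl_connected (hW v) (hW0 v)
    · change ((cycleGraph _).induce (ψ v)).Connected
      rw [hψI hv]
      refine induce_cycleGraph_connected ⟨?_⟩ ((hφ.trace_nonempty hI hv).image _)
      rintro _ ⟨i, hi, rfl⟩ _ ⟨j, hj, rfl⟩ x ⟨hx, hx'⟩
      have hx : (i : ℕ) + 2 ≤ x := hx
      have hx' : (x : ℕ) ≤ j + 2 := hx'
      exact ⟨⟨x - 2, by omega⟩, (hφ.ordConnected_trace (notMem_of_mem_verts hv)).out hi hj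
        ⟨Fin.le_def.2 (by simp; omega), Fin.le_def.2 (by simp; omega)⟩,
        Fin.ext (by simp [f]; omega)⟩
    · exact induce_cycleGraph_connected Set.ordConnected_singleton (Set.singleton_nonempty _)
  · rintro (⟨u, hu⟩ | b) (⟨v, hv⟩ | b') huv
    · replace huv : u ≠ v := fun h ↦ huv (by subst h; rfl)
      change G.Adj u v ↔ (ψ u ∩ ψ v).Nonempty
      rcases hu with hu | hu <;> rcases hv with hv | hv
      · refine iff_of_true (hφ.adj_of_mem_center hu hv huv) ⟨0, ?_, ?_⟩
        · rw [hψC hu]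
          exact hW0 u
        · rw [hψC hv]
          exact hW0 v
      · exact hCI u hu v hv
      · rw [adj_comm, Set.inter_comm]
        exact hCI v hv u hu
      · rw [hψI hu, hψI hv, ← Set.image_inter hf, Set.image_nonempty,
          hφ.adj_iff_of_mem_verts hI hv huv]
    · exact hb ⟨u, hu⟩ b'
    · rw [Set.inter_comm]
      exact hb ⟨v, hv⟩ b
    · refine iff_of_false id ?_
      have hbb : b ≠ b' := fun h ↦ huv (by rw [h])
      change ¬ ({pt b} ∩ {pt b'} : Set (Fin (m + 3 + 3))).Nonempty
      rw [Set.inter_singleton_nonempty, Set.mem_singleton_iff]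
      intro h
      have := congrArg Fin.val h
      cases b <;> cases b' <;> simp [pt] at this hbb

end IsCenteredModel

end Geometry

/-! ### Finite linear orders given by relations -/

theorem exists_last {α : Type*} {r : α → α → Prop} {S : Set α} (hfin : S.Finite)
    (hne : S.Nonempty) (htrans : ∀ a ∈ S, ∀ b ∈ S, ∀ c ∈ S, r a b → r b c → r a c)
    (htot : ∀ a ∈ S, ∀ b ∈ S, a ≠ b → r a b ∨ r b a) : ∃ a ∈ S, ∀ b ∈ S, b ≠ a → r b a := by
  induction S, hfin using Set.Finite.induction_on with
  | empty => exact (Set.not_nonempty_empty hne).elim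
  | @insert a S ha _ ih =>
    rcases S.eq_empty_or_nonempty with rfl | hS
    · exact ⟨a, Set.mem_insert _ _, fun b hb hba ↦ by simp_all⟩
    · obtain ⟨c, hc, hlast⟩ := ih hS
        (fun x hx y hy z hz ↦ htrans x (.inr hx) y (.inr hy) z (.inr hz))
        (fun x hx y hy ↦ htot x (.inr hx) y (.inr hy))
      have hac : a ≠ c := fun h ↦ ha (h ▸ hc)
      rcases htot a (.inl rfl) c (.inr hc) hac with h | h
      · refine ⟨c, .inr hc, fun b hb hbc ↦ ?_⟩
        rcases hb with rfl | hb
        · exact h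
        · exact hlast b hb hbc
      · refine ⟨a, .inl rfl, fun b hb hba ↦ ?_⟩
        have hb : b ∈ S := hb.resolve_left hba
        by_cases hbc : b = c
        · exact hbc ▸ h
        · exact htrans b (.inr hb) c (.inr hc) a (.inl rfl) (hlast b hb hbc) h

theorem exists_pairwise_list {α : Type*} {r : α → α → Prop} {S : Set α} (hfin : S.Finite)
    (htrans : ∀ a ∈ S, ∀ b ∈ S, ∀ c ∈ S, r a b → r b c → r a c)
    (htot : ∀ a ∈ S, ∀ b ∈ S, a ≠ b → r a b ∨ r b a) :
    ∃ l : List α, l.Pairwise r ∧ l.Nodup ∧ ∀ a, a ∈ l ↔ a ∈ S := by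
  induction hn : S.ncard generalizing S with
  | zero =>
    rw [Set.ncard_eq_zero hfin] at hn
    exact ⟨[], .nil, .nil, fun a ↦ by simp [hn]⟩
  | succ n ih =>
    obtain ⟨a, ha, hlast⟩ := exists_last hfin
      (Set.nonempty_of_ncard_ne_zero (by omega)) htrans htot
    obtain ⟨l, hl, hnd, hmem⟩ := ih (S := S \ {a}) hfin.sdiff
      (fun x hx y hy z hz ↦ htrans x hx.1 y hy.1 z hz.1)
      (fun x hx y hy ↦ htot x hx.1 y hy.1)
      (by rw [Set.ncard_sdiff_singleton_of_mem ha, hn]; rfl)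
    refine ⟨l ++ [a], ?_, ?_, fun b ↦ ?_⟩
    · rw [List.pairwise_append]
      refine ⟨hl, List.pairwise_singleton _ _, fun b hb c hc ↦ ?_⟩
      rw [List.mem_singleton] at hc
      subst hc
      exact hlast b ((hmem b).1 hb).1 ((hmem b).1 hb).2
    · rw [List.nodup_append]
      refine ⟨hnd, List.nodup_singleton _, fun b hb c hc h ↦ ?_⟩
      rw [List.mem_singleton] at hc
      exact ((hmem b).1 hb).2 (h.trans hc)
    · rw [List.mem_append, hmem, List.mem_singleton]
      constructor
      · rintro (h | rfl)
        · exact h.1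
        · exact ha
      · intro h
        by_cases hba : b = a
        · exact .inr hba
        · exact .inl ⟨h, hba⟩

/-! ### The cliques of a list -/

section CliqueAt

variable {V : Type*} {l : List (Set V)}

theorem cliqueAt_zero : cliqueAt ∅ ∅ l 0 = ∅ := rfl

theorem cliqueAt_eq_getElem {i : ℕ} (hi : 1 ≤ i) (hi' : i ≤ l.length) :
    cliqueAt ∅ ∅ l i = l[i - 1] := by
  rw [cliqueAt, if_neg (by omega), List.getD_eq_getElem]

theorem cliqueAt_of_length_lt {i : ℕ} (hi : l.length < i) : cliqueAt ∅ ∅ l i = ∅ := by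
  rw [cliqueAt, if_neg (by omega), List.getD_eq_default]
  omega

theorem cliqueAt_mem {i : ℕ} (hi : 1 ≤ i) (hi' : i ≤ l.length) : cliqueAt ∅ ∅ l i ∈ l := by
  rw [cliqueAt_eq_getElem hi hi']
  exact List.getElem_mem _

theorem exists_cliqueAt_eq {M : Set V} (hM : M ∈ l) :
    ∃ i, 1 ≤ i ∧ i ≤ l.length ∧ cliqueAt ∅ ∅ l i = M := by
  obtain ⟨i, hi, rfl⟩ := List.getElem_of_mem hM
  exact ⟨i + 1, by omega, by omega, cliqueAt_eq_getElem (by omega) (by omega)⟩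

theorem cliqueAt_pairwise {r : Set V → Set V → Prop} (hl : l.Pairwise r) {i j : ℕ} (hi : 1 ≤ i)
    (hij : i < j) (hj : j ≤ l.length) : r (cliqueAt ∅ ∅ l i) (cliqueAt ∅ ∅ l j) := by
  rw [cliqueAt_eq_getElem hi (by omega), cliqueAt_eq_getElem (by omega) hj]
  exact List.pairwise_iff_getElem.1 hl _ _ _ _ (by omega)

end CliqueAt

/-! ### Sweeps -/

section Sweep

variable {V : Type*} {G : SimpleGraph V} {C : Set V} {H : G.Subgraph}

/-- The properties, invariant under reversal, of the order of the components on the circle of a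
`(C,H)`-centered model. -/
structure IsSweep (H : G.Subgraph) (K : Set (Comp G C)) (R : Comp G C → Comp G C → Prop) :
    Prop where
  linear : IsStrictLinearOn K R
  notDeleted : K ⊆ (deleted G C H)ᶜ
  between : ∀ I ∈ K, ∀ J ∈ K, ∀ L ∈ K, R I J → R J L → cl I ∩ cl L ⊆ clStrong J
  isAmbiguous : ∀ I ∈ K, ∀ J ∈ K, I ≠ J → cl I ⊆ cl J → IsAmbiguous I
  isAmbiguous_of_isSimple : ∀ I ∈ K, IsSimple I → IsAmbiguous I
  verts_iff : ∀ v, v ∈ H.verts ↔ ∃ I ∈ K, v ∈ cl I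
  adj_iff : ∀ u v, u ≠ v → (H.Adj u v ↔ ∃ I ∈ K, u ∈ cl I ∧ v ∈ cl I)

theorem IsCenteredModel.isSweep {m s : ℕ} {φ : V → Set (Fin (m + 3) ⊕ Fin (s + 1))}
    (hφ : IsCenteredModel G C H φ) : IsSweep H (onCircle C φ) (precModel φ) where
  linear := hφ.isStrictLinearOn
  -- A deleted component lies on the stick in `φ` itself, so it cannot lie on the circle.
  notDeleted I hI hd := by
    obtain ⟨u, hu⟩ := verts_nonempty I
    obtain ⟨i, hi⟩ := hφ.trace_nonempty hI hu
    obtain ⟨j, hj⟩ := hd.2 m s φ hφ u hu hi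
    cases hj
  between I hI J hJ L hL hIJ hJL v hv := hφ.mem_clStrong_of_between hI hJ hL hIJ hJL hv.1 hv.2
  isAmbiguous I hI J hJ hne hcl := by
    rcases hφ.isStrictLinearOn.2.2 I hI J hJ hne with h | h
    · exact hφ.isAmbiguous_of_precModel hI hJ h hcl
    · exact hφ.isAmbiguous_of_precModel_symm hI hJ h hcl
  isAmbiguous_of_isSimple I hI h := hφ.isAmbiguous_of_isSimple hI h
  verts_iff := hφ.verts_iff
  adj_iff := hφ.adj_iff

theorem IsCliqueOf.subset {M M' : Set V} (hM : IsCliqueOf H M) (h : M' ⊆ M) : IsCliqueOf H M' :=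
  ⟨h.trans hM.1, fun u hu v hv ↦ hM.2 u (h hu) v (h hv)⟩

theorem IsCliqueOf.exists_isMaxCliqueOf [Finite V] {M : Set V} (hM : IsCliqueOf H M) :
    ∃ M', IsMaxCliqueOf H M' ∧ M ⊆ M' := by
  obtain ⟨M', hMM', hmax⟩ := (Set.toFinite {M | IsCliqueOf H M}).exists_le_maximal hM
  exact ⟨M', ⟨hmax.prop, fun L hL hle ↦ (hmax.eq_of_le hL hle).symm⟩, hMM'⟩

theorem IsMaxCliqueOf.nonempty (hH : H.verts.Nonempty) {M : Set V} (hM : IsMaxCliqueOf H M) :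
    M.Nonempty := by
  obtain ⟨v, hv⟩ := hH
  rw [Set.nonempty_iff_ne_empty]
  rintro rfl
  have := hM.2 {v} ⟨by simpa using hv, by rintro _ rfl _ rfl h; exact (h rfl).elim⟩
    (Set.empty_subset _)
  exact Set.singleton_ne_empty v this

/-- The zone on the side of `N` of the clique `M`. -/
def sideZone (H : G.Subgraph) (K : Set (Comp G C)) (R : Comp G C → Comp G C → Prop)
    (N M : Set V) : Set (Comp G C) :=
  {I | I ∈ K ∧ SetPrec R {I} (inner H K M) ∧ (cl I ∩ (M \ N)).Nonempty}

/-- `N` is the maximal clique preceding `M`, or `∅` if there is none. -/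
structure IsPred (H : G.Subgraph) (K : Set (Comp G C)) (R : Comp G C → Comp G C → Prop)
    (N M : Set V) : Prop where
  eq_empty_or : N = ∅ ∨ IsMaxCliqueOf H N ∧ SetPrec R (inner H K N) (inner H K M)
  inter_subset : ∀ M', IsMaxCliqueOf H M' → SetPrec R (inner H K M') (inner H K M) → M' ∩ M ⊆ N

namespace IsSweep

variable {K : Set (Comp G C)} {R : Comp G C → Comp G C → Prop}

/-- This transfers every statement about left zones to right zones. -/
theorem symm (S : IsSweep H K R) : IsSweep H K (fun I J ↦ R J I) where
  linear := ⟨S.linear.1, fun I hI J hJ L hL h h' ↦ S.linear.2.1 L hL J hJ I hI h' h,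
    fun I hI J hJ h ↦ S.linear.2.2 J hJ I hI h.symm⟩
  notDeleted := S.notDeleted
  between I hI J hJ L hL h h' := by
    rw [Set.inter_comm]
    exact S.between L hL J hJ I hI h' h
  isAmbiguous := S.isAmbiguous
  isAmbiguous_of_isSimple := S.isAmbiguous_of_isSimple
  verts_iff := S.verts_iff
  adj_iff := S.adj_iff

variable (S : IsSweep H K R)

include S

theorem mem_inner {M : Set V} {I : Comp G C} : I ∈ inner H K M ↔ I ∈ K ∧ cl I = M :=
  ⟨fun h ↦ ⟨h.2, h.1.2⟩, fun h ↦ ⟨⟨S.notDeleted h.1, h.2⟩, h.1⟩⟩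

theorem rel_of_not_rel {I J : Comp G C} (hI : I ∈ K) (hJ : J ∈ K) (hne : I ≠ J) (h : ¬ R J I) :
    R I J :=
  (S.linear.2.2 I hI J hJ hne).resolve_right h

theorem asymm {I J : Comp G C} (hI : I ∈ K) (hJ : J ∈ K) (h : R I J) : ¬ R J I :=
  fun h' ↦ S.linear.1 I hI (S.linear.2.1 I hI J hJ I hI h h')

theorem ne_of_rel {I J : Comp G C} (hI : I ∈ K) (h : R I J) : I ≠ J := by
  rintro rfl
  exact S.linear.1 I hI h

theorem exists_last [Finite V] {Z : Set (Comp G C)} (hZ : Z ⊆ K) (hne : Z.Nonempty) :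
    ∃ I ∈ Z, ∀ J ∈ Z, J ≠ I → R J I :=
  CenteredLollipop.exists_last Z.toFinite hne
    (fun a ha b hb c hc ↦ S.linear.2.1 a (hZ ha) b (hZ hb) c (hZ hc))
    (fun a ha b hb ↦ S.linear.2.2 a (hZ ha) b (hZ hb))

theorem isCliqueOf_cl {I : Comp G C} (hI : I ∈ K) : IsCliqueOf H (cl I) :=
  ⟨fun v hv ↦ (S.verts_iff v).2 ⟨I, hI, hv⟩,
    fun u hu v hv huv ↦ (S.adj_iff u v huv).2 ⟨I, hI, hu, hv⟩⟩

/-- The Helly property: every maximal clique of `H` is the clique of a component. -/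
theorem inner_nonempty [Finite V] (hH : H.verts.Nonempty) {M : Set V} (hM : IsMaxCliqueOf H M) :
    (inner H K M).Nonempty := by
  have hlast : ∀ v ∈ M, ∃ I ∈ K, v ∈ cl I ∧ ∀ J ∈ K, v ∈ cl J → J ≠ I → R J I := by
    intro v hv
    obtain ⟨I₀, hI₀, hv₀⟩ := (S.verts_iff v).1 (hM.1.1 hv)
    obtain ⟨I, ⟨hI, hvI⟩, h⟩ := S.exists_last (Z := {I | I ∈ K ∧ v ∈ cl I}) (fun _ h ↦ h.1)
      ⟨I₀, hI₀, hv₀⟩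
    exact ⟨I, hI, hvI, fun J hJ hvJ ↦ h J ⟨hJ, hvJ⟩⟩
  obtain ⟨v₀, hv₀⟩ := hM.nonempty hH
  -- Among the last components of the vertices of `M`, `I` is the earliest, attained by `v`. Any
  -- other `u` in `M` shares a component with `v`, not after `I`, while its own last component is
  -- not before `I`; betweenness puts `u` into `cl I`.
  obtain ⟨I, ⟨hI, v, hv, hvI, hvlast⟩, hfirst⟩ := S.symm.exists_last
    (Z := {I | I ∈ K ∧ ∃ v ∈ M, v ∈ cl I ∧ ∀ J ∈ K, v ∈ cl J → J ≠ I → R J I}) (fun _ h ↦ h.1)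
    (by obtain ⟨I, hI, h⟩ := hlast v₀ hv₀
        exact ⟨I, hI, v₀, hv₀, h⟩)
  refine ⟨I, S.mem_inner.2 ⟨hI, hM.2 _ (S.isCliqueOf_cl hI) fun u hu ↦ ?_⟩⟩
  by_cases huv : u = v
  · exact huv ▸ hvI
  obtain ⟨L, hL, huL, hLlast⟩ := hlast u hu
  by_cases hLI : L = I
  · exact hLI ▸ huL
  obtain ⟨J, hJ, huJ, hvJ⟩ := (S.adj_iff u v huv).1 (hM.1.2 u hu v hv huv)
  by_cases hJI : J = I
  · exact hJI ▸ huJ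
  exact clStrong_subset_cl I (S.between J hJ I hI L hL (hvlast J hJ hvJ hJI)
    (hfirst L ⟨hL, u, hu, huL, hLlast⟩ hLI) ⟨huJ, huL⟩)

theorem inner_interval {M : Set V} (hM : IsMaxCliqueOf H M) {I J L : Comp G C}
    (hI : I ∈ inner H K M) (hJ : J ∈ K) (hL : L ∈ inner H K M) (hIJ : R I J) (hJL : R J L) :
    J ∈ inner H K M ∧ M ⊆ clStrong J := by
  rw [S.mem_inner] at hI hL
  have h := S.between I hI.1 J hJ L hL.1 hIJ hJL
  rw [hI.2, hL.2, Set.inter_self] at h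
  exact ⟨S.mem_inner.2 ⟨hJ, hM.2 _ (S.isCliqueOf_cl hJ) (h.trans (clStrong_subset_cl J))⟩, h⟩

/-- The two inner sets are disjoint intervals of the order, so one comparison decides all. -/
theorem setPrec_of_rel {M M' : Set V} (hM : IsMaxCliqueOf H M) (hM' : IsMaxCliqueOf H M')
    (hne : M ≠ M') {I I' : Comp G C} (hI : I ∈ inner H K M) (hI' : I' ∈ inner H K M')
    (h : R I I') : SetPrec R (inner H K M) (inner H K M') := by
  have hdisj : ∀ L, L ∈ inner H K M → L ∉ inner H K M' := fun L h h' ↦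
    hne ((S.mem_inner.1 h).2.symm.trans (S.mem_inner.1 h').2)
  intro J hJ J' hJ'
  have hJI' : R J I' := S.rel_of_not_rel hJ.2 hI'.2 (fun h ↦ hdisj _ hJ (h ▸ hI'))
    fun h' ↦ hdisj _ (S.inner_interval hM hI hI'.2 hJ h h').1 hI'
  exact S.rel_of_not_rel hJ.2 hJ'.2 (fun h ↦ hdisj _ hJ (h ▸ hJ'))
    fun h' ↦ hdisj _ hJ (S.inner_interval hM' hJ' hJ.2 hI' h' hJI').1

theorem setPrec_or_setPrec [Finite V] (hH : H.verts.Nonempty) {M M' : Set V}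
    (hM : IsMaxCliqueOf H M) (hM' : IsMaxCliqueOf H M') (hne : M ≠ M') :
    SetPrec R (inner H K M) (inner H K M') ∨ SetPrec R (inner H K M') (inner H K M) := by
  obtain ⟨I, hI⟩ := S.inner_nonempty hH hM
  obtain ⟨I', hI'⟩ := S.inner_nonempty hH hM'
  have hII' : I ≠ I' := by
    rintro rfl
    exact hne ((S.mem_inner.1 hI).2.symm.trans (S.mem_inner.1 hI').2)
  rcases S.linear.2.2 I hI.2 I' hI'.2 hII' with h | h
  · exact .inl (S.setPrec_of_rel hM hM' hne hI hI' h)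
  · exact .inr (S.setPrec_of_rel hM' hM hne.symm hI' hI h)

theorem setPrec_trans {A B D : Set (Comp G C)} (hA : A ⊆ K) (hB : B ⊆ K) (hD : D ⊆ K)
    (hne : B.Nonempty) (h : SetPrec R A B) (h' : SetPrec R B D) : SetPrec R A D := by
  obtain ⟨b, hb⟩ := hne
  exact fun a ha d hd ↦ S.linear.2.1 a (hA ha) b (hB hb) d (hD hd) (h a ha b hb) (h' b hb d hd)

theorem setPrec_singleton_or [Finite V] (hH : H.verts.Nonempty) {M : Set V}
    (hM : IsMaxCliqueOf H M) {I : Comp G C} (hI : I ∈ K) (hIM : I ∉ inner H K M) :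
    SetPrec R {I} (inner H K M) ∨ SetPrec R (inner H K M) {I} := by
  obtain ⟨J, hJ⟩ := S.inner_nonempty hH hM
  have hne : ∀ L ∈ inner H K M, I ≠ L := fun L hL h ↦ hIM (h ▸ hL)
  rcases S.linear.2.2 I hI J hJ.2 (hne J hJ) with h | h
  · left
    rintro _ rfl L hL
    exact S.rel_of_not_rel hI hL.2 (hne L hL) fun h' ↦
      hIM (S.inner_interval hM hL hI hJ h' h).1
  · right
    rintro L hL _ rfl
    exact S.rel_of_not_rel hL.2 hI (hne L hL).symm fun h' ↦
      hIM (S.inner_interval hM hJ hI hL h h').1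

/-! ### Zones beside a maximal clique -/

section SideZone

variable [Finite V] (hH : H.verts.Nonempty) {N M : Set V} (hM : IsMaxCliqueOf H M)
  (hN : IsPred H K R N M)

include hH hM hN

/-- Extend `cl I` to a maximal clique `M'`. If `M'` precedes `M`, then `x ∈ M' ∩ M ⊆ N`, contrary to
the choice of `x`. If `M'` follows `M`, the components of `M` lie between `I` and those of `M'`, so
`cl I ⊆ M` by betweenness. -/
theorem cl_subset_of_mem_sideZone {I : Comp G C} (hI : I ∈ sideZone H K R N M) : cl I ⊆ M := by
  obtain ⟨hIK, hIM, x, hx, hxM, hxN⟩ := hI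
  obtain ⟨M', hM', hsub⟩ := (S.isCliqueOf_cl hIK).exists_isMaxCliqueOf
  by_cases hne : M' = M
  · exact hne ▸ hsub
  rcases S.setPrec_or_setPrec hH hM' hM hne with h | h
  · exact (hxN (hN.inter_subset M' hM' h ⟨hsub hx, hxM⟩)).elim
  · intro v hv
    obtain ⟨J, hJ⟩ := S.inner_nonempty hH hM
    obtain ⟨J', hJ'⟩ := S.inner_nonempty hH hM'
    have := S.between I hIK J hJ.2 J' hJ'.2 (hIM I rfl J hJ) (h J hJ J' hJ')
      ⟨hv, (S.mem_inner.1 hJ').2 ▸ hsub hv⟩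
    exact (S.mem_inner.1 hJ).2 ▸ clStrong_subset_cl J this

omit hN in
theorem setPrec_inner_of_mem_sideZone (hNM : SetPrec R (inner H K N) (inner H K M))
    {I : Comp G C} (hI : I ∈ sideZone H K R N M) : SetPrec R (inner H K N) {I} := by
  obtain ⟨hIK, hIM, x, hx, hxM, hxN⟩ := hI
  rintro L hL _ rfl
  have hclL := (S.mem_inner.1 hL).2
  refine S.rel_of_not_rel hL.2 hIK (fun h ↦ hxN (hclL ▸ h ▸ hx)) fun h ↦ hxN ?_
  obtain ⟨J, hJ⟩ := S.inner_nonempty hH hM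
  have := S.between _ hIK L hL.2 J hJ.2 h (hNM L hL J hJ) ⟨hx, (S.mem_inner.1 hJ).2 ▸ hxM⟩
  exact hclL ▸ clStrong_subset_cl L this

theorem inter_subset_clStrong_of_mem_sideZone {I : Comp G C} (hI : I ∈ sideZone H K R N M) :
    N ∩ M ⊆ clStrong I := by
  rcases hN.eq_empty_or with rfl | ⟨hNmax, hNM⟩
  · simp
  obtain ⟨L, hL⟩ := S.inner_nonempty hH hNmax
  obtain ⟨J, hJ⟩ := S.inner_nonempty hH hM
  have := S.between L hL.2 I hI.1 J hJ.2
    (S.setPrec_inner_of_mem_sideZone hH hM hNM hI L hL I rfl) (hI.2.1 I rfl J hJ)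
  rwa [(S.mem_inner.1 hL).2, (S.mem_inner.1 hJ).2] at this

theorem isAmbiguous_of_mem_sideZone {I : Comp G C} (hI : I ∈ sideZone H K R N M) :
    IsAmbiguous I := by
  obtain ⟨J, hJ⟩ := S.inner_nonempty hH hM
  refine S.isAmbiguous I hI.1 J hJ.2 (S.ne_of_rel hI.1 (hI.2.1 I rfl J hJ)) ?_
  rw [(S.mem_inner.1 hJ).2]
  exact S.cl_subset_of_mem_sideZone hH hM hN hI

theorem sqLT_of_mem_sideZone {I J : Comp G C} (hI : I ∈ sideZone H K R N M)
    (hJ : J ∈ sideZone H K R N M) (h : R I J) : sqLT I J := by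
  obtain ⟨L, hL⟩ := S.inner_nonempty hH hM
  refine ⟨S.ne_of_rel hI.1 h, fun v hv ↦
    S.between I hI.1 J hJ.1 L hL.2 h (hJ.2.1 J rfl L hL) ⟨hv, ?_⟩⟩
  rw [(S.mem_inner.1 hL).2]
  exact S.cl_subset_of_mem_sideZone hH hM hN hI hv

theorem respectsBorder_sideZone : RespectsBorder (sideZone H K R N M) (N ∩ M) := by
  refine ⟨⟨fun I hI ↦ S.isAmbiguous_of_mem_sideZone hH hM hN hI, fun I hI J hJ ↦ ?_⟩,
    fun I hI ↦ S.inter_subset_clStrong_of_mem_sideZone hH hM hN hI⟩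
  by_cases hIJ : I = J
  · exact .inl (.inl hIJ)
  rcases S.linear.2.2 I hI.1 J hJ.1 hIJ with h | h
  · exact .inl (.inr (S.sqLT_of_mem_sideZone hH hM hN hI hJ h))
  · exact .inr (.inr (S.sqLT_of_mem_sideZone hH hM hN hJ hI h))

/-- If the order disagreed, `I` and `J` would be below each other. All four sets `cl` and `clStrong`
would then coincide, making both components simple with the same clique. -/
theorem sqLT_iff_of_mem_sideZone (hsimple : SimpleDistinct G C) {I J : Comp G C}
    (hI : I ∈ sideZone H K R N M) (hJ : J ∈ sideZone H K R N M) : sqLT I J ↔ R I J := by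
  refine ⟨fun h ↦ S.rel_of_not_rel hI.1 hJ.1 h.1 fun h' ↦ h.1 ?_,
    S.sqLT_of_mem_sideZone hH hM hN hI hJ⟩
  have h'' := S.sqLT_of_mem_sideZone hH hM hN hJ hI h'
  have h1 := clStrong_subset_cl I
  have h2 := clStrong_subset_cl J
  exact hsimple I J (S.isAmbiguous_of_mem_sideZone hH hM hN hI)
    ((h.2.trans (h2.trans h''.2)).antisymm h1)
    (S.isAmbiguous_of_mem_sideZone hH hM hN hJ)
    ((h''.2.trans (h1.trans h.2)).antisymm h2)
    ((h.2.trans h2).antisymm (h''.2.trans h1))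

/-- The second component `L` is essential: `F` lies strictly between `I` and `L`, and `cl L = M`
contains `cl I`. -/
theorem sqLT_first {F L : Comp G C} (hF : F ∈ inner H K M) (hL : L ∈ inner H K M) (hFL : R F L)
    {I : Comp G C} (hI : I ∈ sideZone H K R N M) : sqLT I F := by
  have hIF := hI.2.1 I rfl F hF
  refine ⟨S.ne_of_rel hI.1 hIF, fun v hv ↦ S.between I hI.1 F hF.2 L hL.2 hIF hFL ⟨hv, ?_⟩⟩
  rw [(S.mem_inner.1 hL).2]
  exact S.cl_subset_of_mem_sideZone hH hM hN hI hv

theorem respectsBorder_union_first {F L : Comp G C} (hF : F ∈ inner H K M)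
    (hL : L ∈ inner H K M) (hFL : R F L) :
    RespectsBorder (sideZone H K R N M ∪ {F}) (N ∩ M) := by
  obtain ⟨⟨hamb, hchain⟩, hresp⟩ := S.respectsBorder_sideZone hH hM hN
  refine ⟨⟨?_, ?_⟩, ?_⟩
  · rintro I (hI | rfl)
    · exact hamb I hI
    · refine S.isAmbiguous I hF.2 L hL.2 (S.ne_of_rel hF.2 hFL) ?_
      rw [(S.mem_inner.1 hF).2, (S.mem_inner.1 hL).2]
  · rintro I (hI | rfl) J (hJ | rfl)
    · exact hchain I hI J hJ
    · exact .inl (.inr (S.sqLT_first hH hM hN hF hL hFL hI))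
    · exact .inr (.inr (S.sqLT_first hH hM hN hF hL hFL hJ))
    · exact .inl (.inl rfl)
  · rintro I (hI | rfl)
    · exact hresp I hI
    · rcases hN.eq_empty_or with rfl | ⟨hNmax, hNM⟩
      · simp
      obtain ⟨J, hJ⟩ := S.inner_nonempty hH hNmax
      have := S.between J hJ.2 I hF.2 L hL.2 (hNM J hJ I hF) hFL
      rwa [(S.mem_inner.1 hJ).2, (S.mem_inner.1 hL).2] at this

/-- The final clause supplies, for each vertex of the side clique, the component beyond `inner` that
`isCircularArc_extGraph` asks for. -/
theorem exists_isSideClique : ∃ D, IsSideClique (sideZone H K R N M) (N ∩ M) D ∧ D ⊆ M ∧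
    ∀ v ∈ D, ∃ J ∈ K, (∀ I ∈ inner H K M, R J I) ∧ v ∈ cl J := by
  rcases (sideZone H K R N M).eq_empty_or_nonempty with h | h
  · refine ⟨N ∩ M, .inr ⟨h, rfl⟩, Set.inter_subset_right, fun v hv ↦ ?_⟩
    rcases hN.eq_empty_or with rfl | ⟨hNmax, hNM⟩
    · exact hv.1.elim
    obtain ⟨J, hJ⟩ := S.inner_nonempty hH hNmax
    exact ⟨J, hJ.2, hNM J hJ, (S.mem_inner.1 hJ).2 ▸ hv.1⟩
  · obtain ⟨I, hI, hlast⟩ := S.exists_last (fun I hI ↦ hI.1) h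
    refine ⟨cl I, .inl ⟨I, hI, fun J hJ ↦ ?_, rfl⟩, S.cl_subset_of_mem_sideZone hH hM hN hI,
      fun v hv ↦ ⟨I, hI.1, hI.2.1 I rfl, hv⟩⟩
    by_cases hJI : J = I
    · exact .inl hJI
    · exact .inr (S.sqLT_of_mem_sideZone hH hM hN hJ hI (hlast J hJ hJI))

/-- In the wrong order, `J` would lie between `inner N` and `I`. The vertex `y ∈ N \ M` of `cl I`
would then belong to `cl J ⊆ M`. -/
theorem rel_of_mem_sideZone (hNmax : IsMaxCliqueOf H N)
    (hNM : SetPrec R (inner H K N) (inner H K M)) {I J : Comp G C}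
    (hI : I ∈ sideZone H K (fun I J ↦ R J I) M N) (hJ : J ∈ sideZone H K R N M) : R I J := by
  obtain ⟨L, hL⟩ := S.inner_nonempty hH hNmax
  obtain ⟨y, hyI, hyN, hyM⟩ := hI.2.2
  have hJM := S.cl_subset_of_mem_sideZone hH hM hN hJ
  refine S.rel_of_not_rel hI.1 hJ.1 (fun h ↦ hyM (hJM (h ▸ hyI))) fun h ↦ hyM (hJM ?_)
  exact clStrong_subset_cl J (S.between L hL.2 J hJ.1 I hI.1
    (S.setPrec_inner_of_mem_sideZone hH hM hNM hJ L hL J rfl) h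
    ⟨(S.mem_inner.1 hL).2 ▸ hyN, hyI⟩)

end SideZone

end IsSweep

end Sweep

/-! ### The induced order of the maximal cliques and the partition into zones -/

section LeafOrder

variable {V : Type*} {G : SimpleGraph V} {C : Set V} {H : G.Subgraph}
  {K : Set (Comp G C)} {R : Comp G C → Comp G C → Prop} {l : List (Set V)}

/-- `l` lists the maximal cliques of `H` in the order of their components. -/
structure IsLeafOrder (H : G.Subgraph) (K : Set (Comp G C)) (R : Comp G C → Comp G C → Prop)
    (l : List (Set V)) : Prop where
  pairwise : l.Pairwise fun M M' ↦ SetPrec R (inner H K M) (inner H K M')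
  nodup : l.Nodup
  mem_iff : ∀ M, M ∈ l ↔ IsMaxCliqueOf H M

theorem IsLeafOrder.isMaxCliqueOf (hl : IsLeafOrder H K R l) {i : ℕ} (hi : 1 ≤ i)
    (hi' : i ≤ l.length) : IsMaxCliqueOf H (cliqueAt ∅ ∅ l i) :=
  (hl.mem_iff _).1 (cliqueAt_mem hi hi')

theorem IsLeafOrder.setPrec (hl : IsLeafOrder H K R l) {i j : ℕ} (hi : 1 ≤ i) (hij : i < j)
    (hj : j ≤ l.length) :
    SetPrec R (inner H K (cliqueAt ∅ ∅ l i)) (inner H K (cliqueAt ∅ ∅ l j)) :=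
  cliqueAt_pairwise hl.pairwise hi hij hj

namespace IsSweep

variable (S : IsSweep H K R)

include S

theorem exists_isLeafOrder [Finite V] (hH : H.verts.Nonempty) : ∃ l, IsLeafOrder H K R l := by
  obtain ⟨l, h1, h2, h3⟩ := exists_pairwise_list
    (r := fun M M' ↦ SetPrec R (inner H K M) (inner H K M')) (S := {M | IsMaxCliqueOf H M})
    (Set.toFinite _)
    (fun M _ M' hM' M'' _ ↦ S.setPrec_trans (fun _ h ↦ h.2) (fun _ h ↦ h.2) (fun _ h ↦ h.2)
      (S.inner_nonempty hH hM'))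
    (fun M hM M' hM' hne ↦ S.setPrec_or_setPrec hH hM hM' hne)
  exact ⟨l, h1, h2, h3⟩

variable [Finite V] (hH : H.verts.Nonempty) (hl : IsLeafOrder H K R l)

include hH hl

theorem inner_cliqueAt_nonempty {i : ℕ} (hi : 1 ≤ i) (hi' : i ≤ l.length) :
    (inner H K (cliqueAt ∅ ∅ l i)).Nonempty :=
  S.inner_nonempty hH (hl.isMaxCliqueOf hi hi')

theorem lt_of_setPrec {i j : ℕ} (hi : 1 ≤ i) (hi' : i ≤ l.length) (hj : 1 ≤ j)
    (h : SetPrec R (inner H K (cliqueAt ∅ ∅ l i)) (inner H K (cliqueAt ∅ ∅ l j))) : i < j := by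
  obtain ⟨I, hI⟩ := S.inner_cliqueAt_nonempty hH hl hi hi'
  by_contra! hji
  rcases hji.eq_or_lt with rfl | hji
  · exact S.linear.1 I hI.2 (h I hI I hI)
  · obtain ⟨J, hJ⟩ := S.inner_cliqueAt_nonempty hH hl hj (by omega)
    exact S.asymm hI.2 hJ.2 (h I hI J hJ) (hl.setPrec hj hji hi' J hJ I hI)

theorem isConsecutive : IsConsecutive H l := by
  refine ⟨hl.nodup, hl.mem_iff, fun v i j k hi hij hjk hk hvi hvk ↦ ?_⟩
  rcases hij.eq_or_lt with rfl | hij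
  · exact hvi
  rcases hjk.eq_or_lt with rfl | hjk
  · exact hvk
  obtain ⟨I, hI⟩ := S.inner_cliqueAt_nonempty hH hl hi (by omega)
  obtain ⟨J, hJ⟩ := S.inner_cliqueAt_nonempty hH hl (i := j) (by omega) (by omega)
  obtain ⟨L, hL⟩ := S.inner_cliqueAt_nonempty hH hl (i := k) (by omega) hk
  have := S.between I hI.2 J hJ.2 L hL.2 (hl.setPrec hi hij (by omega) I hI J hJ)
    (hl.setPrec (by omega) hjk hk J hJ L hL)
    ⟨(S.mem_inner.1 hI).2 ▸ hvi, (S.mem_inner.1 hL).2 ▸ hvk⟩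
  exact (S.mem_inner.1 hJ).2 ▸ clStrong_subset_cl J this

theorem isPred_left {i : ℕ} (hi : 1 ≤ i) (hi' : i ≤ l.length) :
    IsPred H K R (cliqueAt ∅ ∅ l (i - 1)) (cliqueAt ∅ ∅ l i) where
  eq_empty_or := by
    rcases hi.eq_or_lt with rfl | h1
    · exact .inl cliqueAt_zero
    · exact .inr ⟨hl.isMaxCliqueOf (by omega) (by omega),
        hl.setPrec (by omega) (by omega) hi'⟩
  inter_subset M' hM' h v hv := by
    obtain ⟨j, hj, hj', rfl⟩ := exists_cliqueAt_eq ((hl.mem_iff M').2 hM')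
    have := S.lt_of_setPrec hH hl hj hj' hi h
    exact (S.isConsecutive hH hl).2.2 v j (i - 1) i hj (by omega) (by omega) hi' hv.1 hv.2

theorem isPred_right {i : ℕ} (hi : 1 ≤ i) (hi' : i ≤ l.length) :
    IsPred H K (fun I J ↦ R J I) (cliqueAt ∅ ∅ l (i + 1)) (cliqueAt ∅ ∅ l i) where
  eq_empty_or := by
    rcases hi'.eq_or_lt with rfl | h1
    · exact .inl (cliqueAt_of_length_lt (by omega))
    · exact .inr ⟨hl.isMaxCliqueOf (by omega) (by omega),
        fun I hI J hJ ↦ hl.setPrec hi (by omega) (by omega) J hJ I hI⟩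
  inter_subset M' hM' h v hv := by
    obtain ⟨j, hj, hj', rfl⟩ := exists_cliqueAt_eq ((hl.mem_iff M').2 hM')
    have := S.lt_of_setPrec hH hl hi hi' hj fun I hI J hJ ↦ h J hJ I hI
    exact (S.isConsecutive hH hl).2.2 v i (i + 1) j hi (by omega) (by omega) hj' hv.2 hv.1

omit S [Finite V] hH hl in
theorem zoneR_eq (i : ℕ) : zoneR H K R l i =
    sideZone H K (fun I J ↦ R J I) (cliqueAt ∅ ∅ l (i + 1)) (cliqueAt ∅ ∅ l i) := by
  ext I
  exact and_congr_right fun _ ↦ and_congr_left fun _ ↦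
    ⟨fun h J hJ L hL ↦ h L hL J hJ, fun h J hJ L hL ↦ h L hL J hJ⟩

omit S [Finite V] hH hl in
theorem zone_subset (i : ℕ) : zone H K R l i ⊆ K := by
  rintro I ((h | h) | h)
  · exact h.1
  · exact h.2
  · exact h.1

theorem rel_of_mem_zone_of_mem_inner_succ {i : ℕ} (hi : 1 ≤ i) (hi' : i + 1 ≤ l.length) :
    SetPrec R (zone H K R l i) (inner H K (cliqueAt ∅ ∅ l (i + 1))) := by
  have hprec := hl.setPrec hi (Nat.lt_succ_self i) hi'
  rintro I ((h | h) | h) J hJ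
  · exact S.setPrec_trans (Set.singleton_subset_iff.2 h.1) (fun _ h ↦ h.2) (fun _ h ↦ h.2)
      (S.inner_cliqueAt_nonempty hH hl hi (by omega)) h.2.1 hprec I rfl J hJ
  · exact hprec I h J hJ
  · rw [zoneR_eq] at h
    exact S.symm.setPrec_inner_of_mem_sideZone hH (hl.isMaxCliqueOf hi (by omega))
      (fun I hI J hJ ↦ hprec J hJ I hI) h J hJ I rfl

theorem rel_of_mem_inner_of_mem_zone_succ {i : ℕ} (hi : 1 ≤ i) (hi' : i + 1 ≤ l.length) :
    SetPrec R (inner H K (cliqueAt ∅ ∅ l i)) (zone H K R l (i + 1)) := by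
  have hprec := hl.setPrec hi (Nat.lt_succ_self i) hi'
  rintro I hI J ((h | h) | h)
  · exact S.setPrec_inner_of_mem_sideZone hH (hl.isMaxCliqueOf (by omega) hi') hprec h I hI J rfl
  · exact hprec I hI J h
  · exact S.setPrec_trans (fun _ h ↦ h.2) (fun _ h ↦ h.2) (Set.singleton_subset_iff.2 h.1)
      (S.inner_cliqueAt_nonempty hH hl (by omega) hi') hprec h.2.1 I hI J rfl

/-- Only a right zone against the next left zone needs `rel_of_mem_sideZone`; otherwise an inner set
separates the two components or contains one of them. -/
theorem setPrec_zone_succ {i : ℕ} (hi : 1 ≤ i) (hi' : i + 1 ≤ l.length) :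
    SetPrec R (zone H K R l i) (zone H K R l (i + 1)) := by
  intro I hI J hJ
  have hIJ : ∀ L ∈ K, R I L → R L J → R I J := fun L hL ↦
    S.linear.2.1 I (zone_subset i hI) L hL J (zone_subset _ hJ)
  have hA := S.rel_of_mem_zone_of_mem_inner_succ hH hl hi hi' I hI
  have hB := fun L hL ↦ S.rel_of_mem_inner_of_mem_zone_succ hH hl hi hi' L hL J hJ
  obtain ⟨L, hL⟩ := S.inner_cliqueAt_nonempty hH hl hi (by omega)
  obtain ⟨L', hL'⟩ := S.inner_cliqueAt_nonempty hH hl (i := i + 1) (by omega) hi'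
  rcases hI with (hI | hI) | hI
  · exact hIJ L hL.2 (hI.2.1 I rfl L hL) (hB L hL)
  · exact hB I hI
  rcases hJ with (hJ | hJ) | hJ
  · rw [zoneR_eq] at hI
    exact S.rel_of_mem_sideZone hH (hl.isMaxCliqueOf (by omega) hi')
      (S.isPred_left hH hl (by omega) hi') (hl.isMaxCliqueOf hi (by omega))
      (hl.setPrec hi (by omega) hi') hI hJ
  · exact hA J hJ
  · exact hIJ L' hL'.2 (hA L' hL') (hJ.2.1 L' hL' J rfl)

theorem zone_nonempty {i : ℕ} (hi : 1 ≤ i) (hi' : i ≤ l.length) : (zone H K R l i).Nonempty :=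
  (S.inner_cliqueAt_nonempty hH hl hi hi').mono fun _ h ↦ .inl (.inr h)

theorem setPrec_zone {i j : ℕ} (hi : 1 ≤ i) (hij : i < j) (hj : j ≤ l.length) :
    SetPrec R (zone H K R l i) (zone H K R l j) := by
  induction j, hij using Nat.le_induction with
  | base => exact S.setPrec_zone_succ hH hl hi hj
  | succ j hij ih =>
    exact S.setPrec_trans (zone_subset _) (zone_subset _) (zone_subset _)
      (S.zone_nonempty hH hl (by omega) (by omega)) (ih (by omega))
      (S.setPrec_zone_succ hH hl (by omega) hj)

theorem exists_mem_zone (hmin : NoSimpleOnMinimalSector C H) {I : Comp G C} (hI : I ∈ K) :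
    ∃ i, 1 ≤ i ∧ i ≤ l.length ∧ I ∈ zone H K R l i := by
  by_contra! hcon
  have hout : ∀ i, 1 ≤ i → i ≤ l.length → I ∉ inner H K (cliqueAt ∅ ∅ l i) :=
    fun i hi hi' h ↦ hcon i hi hi' (.inl (.inr h))
  -- The gap containing `I`, where `i = 0` and `i = l.length` are the outer gaps. If no gap fitted,
  -- `I` would be pushed past every leaf, and the last gap would fit after all.
  obtain ⟨i, hin, hleft, hright⟩ : ∃ i ≤ l.length,
      (1 ≤ i → SetPrec R (inner H K (cliqueAt ∅ ∅ l i)) {I}) ∧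
      (i + 1 ≤ l.length → SetPrec R {I} (inner H K (cliqueAt ∅ ∅ l (i + 1)))) := by
    by_contra! hno
    have hall : ∀ i ≤ l.length, 1 ≤ i → SetPrec R (inner H K (cliqueAt ∅ ∅ l i)) {I} := by
      intro i
      induction i with
      | zero => omega
      | succ i ih =>
        intro hi _
        exact (S.setPrec_singleton_or hH (hl.isMaxCliqueOf (by omega) hi) hI
          (hout _ (by omega) hi)).resolve_left (hno i (by omega) (ih (by omega))).2
    exact absurd (hno l.length le_rfl (hall _ le_rfl)).1 (by omega)
  have hL : cl I ⊆ cliqueAt ∅ ∅ l i ∪ cliqueAt ∅ ∅ l (i + 1) := by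
    obtain ⟨M, hM, hsub⟩ := (S.isCliqueOf_cl hI).exists_isMaxCliqueOf
    obtain ⟨j, hj, hj', rfl⟩ := exists_cliqueAt_eq ((hl.mem_iff M).2 hM)
    intro v hv
    obtain ⟨J, hJ⟩ := S.inner_cliqueAt_nonempty hH hl hj hj'
    have hvJ : v ∈ cl J := (S.mem_inner.1 hJ).2 ▸ hsub hv
    rcases Nat.lt_or_ge i j with hij | hij
    · right
      rcases (show i + 1 ≤ j from hij).eq_or_lt with rfl | hij
      · exact hsub hv
      obtain ⟨L, hL⟩ := S.inner_cliqueAt_nonempty hH hl (i := i + 1) (by omega) (by omega)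
      exact (S.mem_inner.1 hL).2 ▸ clStrong_subset_cl L (S.between I hI L hL.2 J hJ.2
        (hright (by omega) I rfl L hL) (hl.setPrec (by omega) hij hj' L hL J hJ) ⟨hv, hvJ⟩)
    · left
      rcases hij.eq_or_lt with rfl | hij
      · exact hsub hv
      obtain ⟨L, hL⟩ := S.inner_cliqueAt_nonempty hH hl (i := i) (by omega) hin
      exact (S.mem_inner.1 hL).2 ▸ clStrong_subset_cl L (S.between J hJ.2 L hL.2 I hI
        (hl.setPrec hj hij hin J hJ L hL) (hleft (by omega) L hL I rfl) ⟨hvJ, hv⟩)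
  have hi1 : (cliqueAt ∅ ∅ l i).Nonempty → 1 ≤ i := by
    rintro ⟨v, hv⟩
    by_contra h
    obtain rfl : i = 0 := by omega
    exact hv
  have hi2 : (cliqueAt ∅ ∅ l (i + 1)).Nonempty → i + 1 ≤ l.length := by
    rintro ⟨v, hv⟩
    by_contra h
    rw [cliqueAt_of_length_lt (by omega)] at hv
    exact hv
  -- A vertex of `cl I` in only one of the two cliques would put `I` into the zone of that leaf.
  -- With `h2` this makes `I` simple on a minimal sector.
  have h1 : cl I ⊆ cliqueAt ∅ ∅ l i ∩ cliqueAt ∅ ∅ l (i + 1) := by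
    intro v hv
    by_contra hvn
    by_cases hvi : v ∈ cliqueAt ∅ ∅ l i
    · have hi := hi1 ⟨v, hvi⟩
      exact hcon i hi hin (.inr ⟨hI, hleft hi, v, hv, hvi, fun h ↦ hvn ⟨hvi, h⟩⟩)
    · have hvi' := (hL hv).resolve_left hvi
      have hi := hi2 ⟨v, hvi'⟩
      exact hcon (i + 1) (by omega) hi (.inl (.inl ⟨hI, hright hi, v, hv, hvi', hvi⟩))
  have h2 : cliqueAt ∅ ∅ l i ∩ cliqueAt ∅ ∅ l (i + 1) ⊆ clStrong I := by
    rintro v ⟨hv, hv'⟩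
    have hi := hi1 ⟨v, hv⟩
    have hi' := hi2 ⟨v, hv'⟩
    obtain ⟨J, hJ⟩ := S.inner_cliqueAt_nonempty hH hl hi hin
    obtain ⟨L, hL⟩ := S.inner_cliqueAt_nonempty hH hl (i := i + 1) (by omega) hi'
    exact S.between J hJ.2 I hI L hL.2 (hleft hi J hJ I rfl) (hright hi' I rfl L hL)
      ⟨(S.mem_inner.1 hJ).2 ▸ hv, (S.mem_inner.1 hL).2 ▸ hv'⟩
  have hsimp : IsSimple I := (h1.trans h2).antisymm (clStrong_subset_cl I)
  exact hmin I (S.isAmbiguous_of_isSimple I hI hsimp) hsimp l (S.isConsecutive hH hl) i hin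
    (h1.antisymm (h2.trans (clStrong_subset_cl I)))

omit hH hl [Finite V] in
-- A component strictly between `F` and `L` satisfies `M ⊆ clStrong J` with `cl J = M`, so it is
-- simple and determined by `M`.
theorem inner_diff_eq (hsimple : SimpleDistinct G C) {M : Set V} (hM : IsMaxCliqueOf H M)
    {F L : Comp G C} (hF : F ∈ inner H K M) (hL : L ∈ inner H K M)
    (hfirst : ∀ J ∈ inner H K M, J ≠ F → R F J) (hlast : ∀ J ∈ inner H K M, J ≠ L → R J L) :
    inner H K M \ {F, L} = ∅ ∨
      ∃ J, inner H K M \ {F, L} = {J} ∧ IsAmbiguous J ∧ IsSimple J := by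
  have hsimp : ∀ J ∈ inner H K M \ {F, L}, IsAmbiguous J ∧ IsSimple J := by
    rintro J ⟨hJ, hJn⟩
    simp only [Set.mem_insert_iff, Set.mem_singleton_iff, not_or] at hJn
    have hsub := (S.inner_interval hM hF hJ.2 hL (hfirst J hJ hJn.1) (hlast J hJ hJn.2)).2
    have : IsSimple J :=
      ((S.mem_inner.1 hJ).2.subset.trans hsub).antisymm (clStrong_subset_cl J)
    exact ⟨S.isAmbiguous_of_isSimple J hJ.2 this, this⟩
  rcases (inner H K M \ {F, L}).eq_empty_or_nonempty with h | ⟨J, hJ⟩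
  · exact .inl h
  · refine .inr ⟨J, Set.eq_singleton_iff_unique_mem.2 ⟨hJ, fun J' hJ' ↦ ?_⟩, hsimp J hJ⟩
    exact hsimple J' J (hsimp J' hJ').1 (hsimp J' hJ').2 (hsimp J hJ).1 (hsimp J hJ).2
      ((S.mem_inner.1 hJ'.1).2.trans (S.mem_inner.1 hJ.1).2.symm)

end IsSweep

end LeafOrder

end CenteredLollipop

/-! ### Assembling the conditions of a good order -/

theorem mainTheorem2 {V : Type*} [Finite V] (G : SimpleGraph V) (C : Set V) (H : G.Subgraph)
    (hH : H.verts.Nonempty)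
    (hmin : CenteredLollipop.NoSimpleOnMinimalSector C H)
    (hsimple : CenteredLollipop.SimpleDistinct G C)
    (T : CenteredLollipop.PQTree (Set V)) (hT : CenteredLollipop.IsPQTreeOf H T)
    (m s : ℕ) (φ : V → Set (Fin (m + 3) ⊕ Fin (s + 1)))
    (hφ : CenteredLollipop.IsCenteredModel G C H φ) :
    CenteredLollipop.IsGoodOrder H T ∅ ∅
      (CenteredLollipop.onCircle C φ) (CenteredLollipop.precModel φ) := by
  open CenteredLollipop in
  have S := hφ.isSweep
  obtain ⟨l, hl⟩ := S.exists_isLeafOrder hH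
  refine ⟨S.notDeleted, S.linear, l, ⟨(hT.2 l).2 (S.isConsecutive hH hl),
    fun M hM ↦ S.inner_nonempty hH ((hl.mem_iff M).1 hM),
    fun M hM I hI J hJ L hL h h' ↦
      (S.inner_interval ((hl.mem_iff M).1 hM) hI hJ hL h h').1,
    fun i j hi hij hj ↦ hl.setPrec hi hij hj⟩,
    ⟨fun i hi hi' ↦ S.zone_nonempty hH hl hi hi', fun i j hi hij hj ↦ ?_,
      fun I ↦ ⟨fun hI ↦ S.exists_mem_zone hH hl hmin hI,
        fun ⟨i, _, _, hI⟩ ↦ IsSweep.zone_subset i hI⟩,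
      fun i j hi hij hj ↦ S.setPrec_zone hH hl hi hij hj⟩, fun i hi hi' ↦ ?_⟩
  · rw [Set.disjoint_left]
    exact fun I hI hI' ↦ S.linear.1 I (IsSweep.zone_subset i hI)
      (S.setPrec_zone hH hl hi hij hj I hI I hI')
  have hM := hl.isMaxCliqueOf hi hi'
  have hNL := S.isPred_left hH hl hi hi'
  have hNR := S.isPred_right hH hl hi hi'
  -- The right zone becomes a side zone of the reversed order, with its border in the shape `N ∩ M`.
  rw [IsSweep.zoneR_eq,
    Set.inter_comm (cliqueAt ∅ ∅ l i) (cliqueAt ∅ ∅ l (i + 1))]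
  refine ⟨⟨S.respectsBorder_sideZone hH hM hNL, fun I hI J hJ ↦
      S.sqLT_iff_of_mem_sideZone hH hM hNL hsimple hI hJ⟩,
    ⟨S.symm.respectsBorder_sideZone hH hM hNR, fun I hI J hJ ↦
      S.symm.sqLT_iff_of_mem_sideZone hH hM hNR hsimple hI hJ⟩, fun hnt ↦ ?_, fun I hI ↦ ?_⟩
  · obtain ⟨F, hF, hfirst⟩ := S.symm.exists_last (fun _ h ↦ h.2) hnt.nonempty
    obtain ⟨L, hL, hlast⟩ := S.exists_last (fun _ h ↦ h.2) hnt.nonempty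
    have hFL : precModel φ F L := by
      obtain ⟨J, hJ, hJF⟩ := hnt.exists_ne F
      by_cases h : F = L
      · subst h
        exact (S.asymm hF.2 hJ.2 (hfirst J hJ hJF) (hlast J hJ hJF)).elim
      · exact hlast F hF h
    refine ⟨F, hF, L, hL, hfirst, hlast, fun J hJ ↦ ?_,
      S.inner_diff_eq hsimple hM hF hL hfirst hlast,
      fun J hJ ↦ S.sqLT_first hH hM hNL hF hL hFL hJ,
      S.respectsBorder_union_first hH hM hNL hF hL hFL,
      fun J hJ ↦ S.symm.sqLT_first hH hM hNR hL hF hFL hJ,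
      S.symm.respectsBorder_union_first hH hM hNR hL hF hFL⟩
    obtain ⟨J', hJ', hne⟩ := hnt.exists_ne J
    exact S.isAmbiguous J hJ.2 J' hJ'.2 hne.symm
      ((S.mem_inner.1 hJ).2.trans (S.mem_inner.1 hJ').2.symm).subset
  · have hIm := hI.superset rfl
    obtain ⟨CL, h1, h2, h3⟩ := S.exists_isSideClique hH hM hNL
    obtain ⟨CR, h4, h5, h6⟩ := S.symm.exists_isSideClique hH hM hNR
    refine ⟨CL, CR, h1, h4, hM.1.subset h2, hM.1.subset h5, fun v hv ↦ ?_,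
      hφ.isCircularArc_extGraph hIm.2 (fun v hv ↦ ?_) (fun v hv ↦ ?_)⟩
    -- A vertex in both side cliques is missed by components on both sides of `I`, hence is adjacent
    -- to nothing in `I`.
    · by_contra hcon
      have hvC : v ∈ C := hv.1.1
      simp only [Set.mem_union, Set.mem_sdiff, hvC, true_and, not_or, not_not] at hcon
      obtain ⟨J, hJ, hJI, hvJ⟩ := h3 v hcon.1
      obtain ⟨L, hL, hIL, hvL⟩ := h6 v hcon.2
      exact (S.between J hJ I hIm.2 L hL (hJI I hIm) (hIL I hIm) ⟨hvJ, hvL⟩).2 hv.1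
    · obtain ⟨J, hJ, hJI, hvJ⟩ := h3 v hv
      exact ⟨J, hJ, hJI I hIm, hvJ⟩
    · obtain ⟨J, hJ, hJI, hvJ⟩ := h6 v hv
      exact ⟨J, hJ, hJI I hIm, hvJ⟩
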